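/- Let $N\ge 0$ and consider the fermionic Fock space $\mathcal H$ of $N$ modes ($\dim\mathcal H=2^N$) with annihilation operators $\hat a_i$, standard Majorana operators $\hat q_i=\frac{1}{\sqrt2}(\hat a_i+\hat a_i^\dagger)$, $\hat p_i=\frac{1}{\sqrt2\,\mathrm i}(\hat a_i-\hat a_i^\dagger)$, and Hermitian linear observables $\hat\xi^a=L^a{}_b\,(\hat q_1,\dots,\hat q_N,\hat p_1,\dots,\hat p_N)^b$, $a=1,\dots,2N$, where $L$ is a real invertible $2N\times2N$ matrix. They satisfy $\{\hat\xi^a,\hat\xi^b\}=G^{ab}$ with $G=LL^{\intercal}$, an arbitrary positive definite metric ($L=G=1$ is the standard choice). Put $g=G^{-1}$. Definitions. Let $\mathrm{SO}(2N)=\{M: MGM^\intercal=G,\ \det M=1\}$ and $\mathfrak{so}(2N)=\{K\in\mathbb R^{2N\times2N}: KG=-GK^\intercal\}$; for $K\in\mathfrak{so}(2N)$ let $\hat K=\frac12 g_{ac}K^c{}_b\hat\xi^a\hat\xi^b$. A compatible complex structure is a real $2N\times2N$ matrix $J$ with $J^2=-1$ and $JGJ^\intercal=G$; a Gaussian state vector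 $|J\rangle\in\mathcal H$ is a unit vector with $\frac12(\delta^a{}_b+\mathrm iJ^a{}_b)\hat\xi^b|J\rangle=0$ for all $a$. For a real matrix $M$ put $C_M=\frac12(M-JMJ)$, $D_M=\frac12(M+JMJ)$ and, if $C_M$ is invertible, $Z_M=C_M^{-1}D_M$. For $M_1,M_2\in\mathrm{SO}(2N)$ such that $C_{M_1}$, $C_{M_2^{-1}}$ and $1-Z_{M_1}Z_{M_2^{-1}}$ are invertible, put $\eta(M_1,M_2)=\sum_{i=1}^N\arg\lambda_i$, $\arg\lambda_i\in(-\pi,\pi]$, where $\lambda_1,\dots,\lambda_N$ are the eigenvalues, with algebraic multiplicity, of $1-Z_{M_1}Z_{M_2^{-1}}$ (which commutes with $J$) as a complex linear map of $\mathbb R^{2N}$, with complex scalars acting by $z\cdot v=\mathrm{Re}(z)v+\mathrm{Im}(z)Jv$. Result 3b (Fermions). Let $K\in\mathfrak{so}(2N)$ and let $|J\rangle$ be a Gaussian state vector of a compatible complex structure $J$. (i) There is a compatible complex structure $\tilde J$ with $[K,\tilde J]=0$ and $\det(1-\tilde JJ)\neq0$. (ii) For every such $\tilde J$ there is a unique $T=\sqrt{-\tilde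 JJ}$, that is, a unique $T\in\mathrm{SO}(2N)$ with $T^2=-\tilde JJ$ all of whose complex eigenvalues have positive real part. Moreover, if $\langle J|e^{\hat K}|J\rangle\neq0$, then $\eta(T^{-1},e^K)$ is defined and $$\arg\langle J|e^{\hat K}|J\rangle\equiv-\tfrac14\mathrm{Tr}(K\tilde J)-\tfrac12\,\eta(T^{-1},e^K)\pmod{2\pi}.$$ -/

import Mathlib

open Matrix

noncomputable section

namespace FermionicGaussian

/-- Index set of the `2N` phase space coordinates `(q₁, …, q_N, p₁, …, p_N)`. -/
abbrev Mode (N : ℕ) : Type := Fin N ⊕ Fin N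

/-- Operators on the fermionic Fock space of `N` modes (dimension `2 ^ N`), written as matrices in
the orthonormal occupation number basis; `S : Finset (Fin N)` is the set of occupied modes. -/
abbrev FockOp (N : ℕ) : Type := Matrix (Finset (Fin N)) (Finset (Fin N)) ℂ

/-- Vectors of the fermionic Fock space; the inner product is `⟨φ, ψ⟩ = star φ ⬝ᵥ ψ`. -/
abbrev FockVec (N : ℕ) : Type := Finset (Fin N) → ℂ

/-- The fermionic annihilation operator of mode `i`. -/
def annihilation {N : ℕ} (i : Fin N) : FockOp N :=
  Matrix.of fun S' S =>
    if i ∈ S ∧ S' = S.erase i then (-1 : ℂ) ^ (S.filter (fun j => j < i)).card else 0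

/-- The standard Majorana operators `q = (a + a†) / √2` and `p = (a - a†) / (√2 i)`, which satisfy
`{ξ^a, ξ^b} = δ^{ab}`. -/
def stdMajorana {N : ℕ} : Mode N → FockOp N
  | Sum.inl i => ((Real.sqrt 2 : ℝ) : ℂ)⁻¹ • (annihilation i + (annihilation i)ᴴ)
  | Sum.inr i =>
      (((Real.sqrt 2 : ℝ) : ℂ) * Complex.I)⁻¹ • (annihilation i - (annihilation i)ᴴ)

/-- The linear observables `ξ^a = ∑ b, L^a_b ξ_std^b` belonging to a general linear basis `L` of
the phase space. They satisfy `{ξ^a, ξ^b} = G^{ab}` with `G = L Lᵀ`. -/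
def majorana {N : ℕ} (L : Matrix (Mode N) (Mode N) ℝ) (a : Mode N) : FockOp N :=
  ∑ b, (L a b : ℂ) • stdMajorana b

/-- The operator `K̂ = ½ g_{ac} K^c_b ξ^a ξ^b` with `g = G⁻¹`. -/
def quadraticOp {N : ℕ} (G L K : Matrix (Mode N) (Mode N) ℝ) : FockOp N :=
  (1 / 2 : ℂ) • ∑ a, ∑ b, ((G⁻¹ * K) a b : ℂ) • (majorana L a * majorana L b)

/-- Membership in the Lie algebra `so(2N)` of the metric `G^{ab}`. -/
def IsSoGenerator {ι : Type*} [Fintype ι] (G K : Matrix ι ι ℝ) : Prop :=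
  K * G = -(G * Kᵀ)

/-- Membership in the group `SO(2N)` of the metric `G^{ab}`. -/
def IsSpecialOrthogonal {ι : Type*} [Fintype ι] [DecidableEq ι] (G M : Matrix ι ι ℝ) : Prop :=
  M * G * Mᵀ = G ∧ M.det = 1

/-- Linear complex structures compatible with the metric `G^{ab}`. -/
structure ComplexStructure {ι : Type*} [Fintype ι] [DecidableEq ι] (G : Matrix ι ι ℝ) where
  mat : Matrix ι ι ℝ
  sq : mat * mat = -1
  compat : mat * G * matᵀ = G

/-- `ψ` is a Gaussian state vector `|J⟩`: it is normalized and
`½ (δ^a_b + i J^a_b) ξ^b |J⟩ = 0` for all `a`. -/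
def IsGaussianState {N : ℕ} {G : Matrix (Mode N) (Mode N) ℝ} (L : Matrix (Mode N) (Mode N) ℝ)
    (J : ComplexStructure G) (ψ : FockVec N) : Prop :=
  star ψ ⬝ᵥ ψ = 1 ∧
    ∀ a, ∑ b, ((1 / 2 : ℂ) * ((1 : Matrix (Mode N) (Mode N) ℂ) a b + Complex.I * (J.mat a b : ℂ))) •
      (majorana L b *ᵥ ψ) = 0

namespace ComplexStructure

variable {ι : Type*} [Fintype ι] [DecidableEq ι] {G : Matrix ι ι ℝ}

/-- The phase space, regarded as a complex vector space with `z • v = Re(z) v + Im(z) J v`. -/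
def Space (_J : ComplexStructure G) : Type _ := ι → ℝ

instance (J : ComplexStructure G) : AddCommGroup J.Space :=
  inferInstanceAs (AddCommGroup (ι → ℝ))

instance (J : ComplexStructure G) : Module ℝ J.Space :=
  inferInstanceAs (Module ℝ (ι → ℝ))

/-- A real matrix acting on the phase space. -/
def act (J : ComplexStructure G) (X : Matrix ι ι ℝ) (v : J.Space) : J.Space :=
  Matrix.mulVec (n := ι) X v

theorem act_add (J : ComplexStructure G) (X : Matrix ι ι ℝ) (v w : J.Space) :
    J.act X (v + w) = J.act X v + J.act X w :=
  Matrix.mulVec_add X v w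

theorem act_smul (J : ComplexStructure G) (X : Matrix ι ι ℝ) (r : ℝ) (v : J.Space) :
    J.act X (r • v) = r • J.act X v :=
  Matrix.mulVec_smul X r v

theorem act_act (J : ComplexStructure G) (X Y : Matrix ι ι ℝ) (v : J.Space) :
    J.act X (J.act Y v) = J.act (X * Y) v :=
  Matrix.mulVec_mulVec v X Y

theorem act_mat_mat (J : ComplexStructure G) (v : J.Space) :
    J.act J.mat (J.act J.mat v) = -v := by
  rw [act_act, J.sq]
  exact (Matrix.neg_mulVec v 1).trans (congrArg Neg.neg (Matrix.one_mulVec v))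

instance (J : ComplexStructure G) : Module ℂ J.Space where
  smul z v := z.re • v + z.im • J.act J.mat v
  one_smul v := by
    change (1 : ℂ).re • v + (1 : ℂ).im • J.act J.mat v = v
    simp
  mul_smul z w v := by
    change (z * w).re • v + (z * w).im • J.act J.mat v =
      z.re • (w.re • v + w.im • J.act J.mat v) +
        z.im • J.act J.mat (w.re • v + w.im • J.act J.mat v)
    rw [act_add, act_smul, act_smul, act_mat_mat, Complex.mul_re, Complex.mul_im]
    module
  smul_zero z := by
    change z.re • (0 : J.Space) + z.im • J.act J.mat 0 = 0
    have h : J.act J.mat 0 = 0 := Matrix.mulVec_zero J.mat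
    rw [h, smul_zero, smul_zero, add_zero]
  smul_add z v w := by
    change z.re • (v + w) + z.im • J.act J.mat (v + w) =
      (z.re • v + z.im • J.act J.mat v) + (z.re • w + z.im • J.act J.mat w)
    rw [act_add]
    module
  add_smul z w v := by
    change (z + w).re • v + (z + w).im • J.act J.mat v =
      (z.re • v + z.im • J.act J.mat v) + (w.re • v + w.im • J.act J.mat v)
    rw [Complex.add_re, Complex.add_im]
    module
  zero_smul v := by
    change (0 : ℂ).re • v + (0 : ℂ).im • J.act J.mat v = 0
    simp

theorem smul_def (J : ComplexStructure G) (z : ℂ) (v : J.Space) :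
    z • v = z.re • v + z.im • J.act J.mat v := rfl

instance (J : ComplexStructure G) : Module.Finite ℝ J.Space :=
  inferInstanceAs (Module.Finite ℝ (ι → ℝ))

instance (J : ComplexStructure G) : IsScalarTower ℝ ℂ J.Space where
  smul_assoc r z v := by
    rw [smul_def, smul_def, Complex.smul_re, Complex.smul_im, smul_eq_mul, smul_eq_mul]
    module

instance (J : ComplexStructure G) : Module.Finite ℂ J.Space :=
  Module.Finite.of_restrictScalars_finite ℝ ℂ J.Space

/-- The complex linear part `C_M = ½ (M - J M J)`. -/
def linPart (J : ComplexStructure G) (M : Matrix ι ι ℝ) : Matrix ι ι ℝ :=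
  (1 / 2 : ℝ) • (M - J.mat * M * J.mat)

/-- The complex antilinear part `D_M = ½ (M + J M J)`. -/
def antilinPart (J : ComplexStructure G) (M : Matrix ι ι ℝ) : Matrix ι ι ℝ :=
  (1 / 2 : ℝ) • (M + J.mat * M * J.mat)

theorem mat_mul_linPart (J : ComplexStructure G) (M : Matrix ι ι ℝ) :
    J.mat * J.linPart M = J.linPart M * J.mat := by
  have h1 : J.mat * (J.mat * M * J.mat) = -(M * J.mat) := by
    rw [← mul_assoc, ← mul_assoc, J.sq, neg_one_mul, neg_mul]
  have h2 : J.mat * M * J.mat * J.mat = -(J.mat * M) := by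
    rw [mul_assoc, J.sq, mul_neg_one]
  rw [linPart, mul_smul_comm, smul_mul_assoc, mul_sub, sub_mul, h1, h2]
  congr 1
  abel

/-- The complex linear part of `X` as an endomorphism of the complex vector space `J.Space`; if `X`
commutes with `J`, then this is `X` itself, and it is represented by a complex `N × N` matrix. -/
def toComplex (J : ComplexStructure G) (X : Matrix ι ι ℝ) : J.Space →ₗ[ℂ] J.Space where
  toFun v := J.act (J.linPart X) v
  map_add' v w := J.act_add _ v w
  map_smul' z v := by
    rw [RingHom.id_apply, smul_def, smul_def, act_add, act_smul, act_smul, act_act, act_act,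
      mat_mul_linPart]

/-- `Z_M = C_M⁻¹ D_M`, meaningful when `C_M` is invertible. -/
def zPart (J : ComplexStructure G) (M : Matrix ι ι ℝ) : Matrix ι ι ℝ :=
  (J.linPart M)⁻¹ * J.antilinPart M

/-- The condition under which the cocycle `η(M₁, M₂)` is defined. -/
def EtaDefined (J : ComplexStructure G) (M₁ M₂ : Matrix ι ι ℝ) : Prop :=
  IsUnit (J.linPart M₁) ∧ IsUnit (J.linPart M₂⁻¹) ∧ IsUnit (1 - J.zPart M₁ * J.zPart M₂⁻¹)

/-- The cocycle function `η(M₁, M₂)` with respect to `J`: the sum of the arguments in `(-π, π]` of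
the `N` complex eigenvalues, counted with algebraic multiplicity, of the `J`-complex linear map
`1 - Z_{M₁} Z_{M₂⁻¹}`. -/
def eta (J : ComplexStructure G) (M₁ M₂ : Matrix ι ι ℝ) : ℝ :=
  ((J.toComplex (1 - J.zPart M₁ * J.zPart M₂⁻¹)).charpoly.roots.map Complex.arg).sum

end ComplexStructure

/-- `T = √A` in `SO(2N)`: the square root all of whose complex eigenvalues have positive real
part. -/
def IsPrincipalSqrt {ι : Type*} [Fintype ι] [DecidableEq ι] (G A T : Matrix ι ι ℝ) : Prop :=
  IsSpecialOrthogonal G T ∧ T * T = A ∧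
    ∀ z ∈ spectrum ℂ (T.map (fun x : ℝ => (x : ℂ))), 0 < z.re

/-- The expectation value `⟨J| e^{K̂} |J⟩` in the state vector `ψ = |J⟩`. -/
def expectationExp {N : ℕ} (G L K : Matrix (Mode N) (Mode N) ℝ) (ψ : FockVec N) : ℂ :=
  star ψ ⬝ᵥ (NormedSpace.exp (quadraticOp G L K) *ᵥ ψ)

end FermionicGaussian

end

/-! Write ψ for |J⟩ and φ = e^{K̂}ψ. With P = ½(1 + iJ) and Q = ½(1 − iJ), the operators `linOp L P`
kill ψ and the operators `linOp L Q` kill its bra. Put Z₁ = Z_{T⁻¹}, Z₂ = Z_{e^{-K}}, W = Z₁Z₂, and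
let B be the quadratic operator with coefficient matrix g Z₁ P. It is built from annihilators of ψ
alone, so Bψ = 0 and B is nilpotent (`isNilpotent_quadOp`); hence F(t) = ⟨ψ|e^{tB}|φ⟩ is a
polynomial.

This polynomial joins the wanted number to a known one. F(0) is the expectation value. At t = 1 the
relation J̃T = TJ makes ⟨ψ|e^B a dual Gaussian vector of J̃. Since K commutes with J̃, that bra is a
left eigenvector of K̂ (`dotProduct_quadOp_of_commute`), and ⟨ψ|e^B|ψ⟩ = 1, so F(1) = exp(−(i/4)
Tr(KJ̃)).

In between, the annihilation conditions on bra and ket and the anticommutators determine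
⟨ψ|e^{tB}B|φ⟩ and give 2F′ = −F · tr_ℂ((1 − tW)⁻¹W) (`trace_eq_of_overlap_equations`). This
integrates to F(t)² = F(0)² det_ℂ(1 − tW) near 0. The sign of the square root needs no continuity
argument: because F is a polynomial, the eigenvalues of 1 − W other than 1 have even multiplicity,
and F(1) = F(0)∏s with s holding half of each multiplicity (`exists_paired_roots`). Then η = 2 Σ arg
s, and comparing arguments gives the formula (`arg_expectationExp`); F(1) ≠ 0 excludes 0 from s, so
η is defined.

The rest is real linear algebra after conjugating by L, which turns G into 1. T is the orthogonal
square root with T + Tᵀ positive definite, unique because positive square roots are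
(`exists_isOrthogonalSqrt`, `IsOrthogonalSqrt.unique`). J̃ is assembled from invariant planes of K,
each orientation being chosen to keep a determinant nonzero
(`exists_commuting_complex_structure_on_range`). -/

noncomputable section
namespace FermionicGaussian

/-! ### Canonical anticommutation relations -/

/-- The Jordan–Wigner sign of mode `i` in the occupation set `S`. -/
def jwSign {N : ℕ} (i : Fin N) (S : Finset (Fin N)) : ℂ :=
  (-1 : ℂ) ^ (S.filter (fun j => j < i)).card

theorem jwSign_mul_self {N : ℕ} (i : Fin N) (S : Finset (Fin N)) :
    jwSign i S * jwSign i S = 1 := by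
  rw [jwSign, ← mul_pow]; norm_num

theorem jwSign_insert {N : ℕ} (i j : Fin N) (S : Finset (Fin N)) (hj : j ∉ S) :
    jwSign i (insert j S) = if j < i then -jwSign i S else jwSign i S := by
  unfold jwSign
  rw [Finset.filter_insert]
  split_ifs with h
  · rw [Finset.card_insert_of_notMem (by simp [hj]), pow_succ]; ring
  · rfl

theorem jwSign_erase {N : ℕ} (i j : Fin N) (S : Finset (Fin N)) (hj : j ∈ S) :
    jwSign i (S.erase j) = if j < i then -jwSign i S else jwSign i S := by
  conv_rhs => rw [← Finset.insert_erase hj]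
  rw [jwSign_insert i j _ (Finset.notMem_erase j S)]
  split_ifs <;> simp

theorem annihilation_mulVec {N : ℕ} (i : Fin N) (ψ : FockVec N) (S : Finset (Fin N)) :
    (annihilation i *ᵥ ψ) S = if i ∈ S then 0 else jwSign i S * ψ (insert i S) := by
  rw [mulVec, dotProduct]
  split_ifs with h
  · refine Finset.sum_eq_zero fun U _ => ?_
    rw [annihilation, of_apply, if_neg, zero_mul]
    rintro ⟨_, rfl⟩
    exact Finset.notMem_erase i U h
  · rw [Finset.sum_eq_single (insert i S)]
    · rw [annihilation, of_apply, if_pos ⟨Finset.mem_insert_self i S, (Finset.erase_insert h).symm⟩]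
      change jwSign i (insert i S) * _ = _
      rw [jwSign_insert i i S h, if_neg (lt_irrefl i)]
    · intro U _ hU
      rw [annihilation, of_apply, if_neg, zero_mul]
      rintro ⟨h1, rfl⟩
      exact hU (Finset.insert_erase h1).symm
    · simp

theorem creation_mulVec {N : ℕ} (i : Fin N) (ψ : FockVec N) (S : Finset (Fin N)) :
    ((annihilation i)ᴴ *ᵥ ψ) S = if i ∈ S then jwSign i S * ψ (S.erase i) else 0 := by
  rw [mulVec, dotProduct]
  split_ifs with h
  · rw [Finset.sum_eq_single (S.erase i)]
    · rw [conjTranspose_apply, annihilation, of_apply, if_pos ⟨h, rfl⟩]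
      simp [jwSign]
    · intro U _ hU
      rw [conjTranspose_apply, annihilation, of_apply, if_neg, star_zero, zero_mul]
      rintro ⟨h1, h2⟩
      exact hU h2
    · simp
  · refine Finset.sum_eq_zero fun U _ => ?_
    rw [conjTranspose_apply, annihilation, of_apply, if_neg, star_zero, zero_mul]
    exact fun h' => h h'.1

theorem annihilation_anticomm {N : ℕ} (i j : Fin N) :
    annihilation i * annihilation j + annihilation j * annihilation i = 0 := by
  refine Matrix.ext_iff_mulVec.2 fun ψ => funext fun S => ?_
  rw [add_mulVec, ← mulVec_mulVec, ← mulVec_mulVec, zero_mulVec, Pi.add_apply, Pi.zero_apply,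
    annihilation_mulVec, annihilation_mulVec, annihilation_mulVec, annihilation_mulVec]
  rcases lt_trichotomy i j with h | rfl | h
  · by_cases hi : i ∈ S <;> by_cases hj : j ∈ S <;>
      simp [hi, hj, h.ne, h.ne', jwSign_insert, h, h.not_gt, Finset.insert_comm i j]; ring
  · simp
  · by_cases hi : i ∈ S <;> by_cases hj : j ∈ S <;>
      simp [hi, hj, h.ne, h.ne', jwSign_insert, h, h.not_gt, Finset.insert_comm i j]; ring

theorem annihilation_creation_anticomm {N : ℕ} (i j : Fin N) :
    annihilation i * (annihilation j)ᴴ + (annihilation j)ᴴ * annihilation i =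
      if i = j then 1 else 0 := by
  refine Matrix.ext_iff_mulVec.2 fun ψ => funext fun S => ?_
  rw [add_mulVec, ← mulVec_mulVec, ← mulVec_mulVec, Pi.add_apply]
  simp only [annihilation_mulVec, creation_mulVec]
  have key := jwSign_mul_self i S
  rcases lt_trichotomy i j with h | rfl | h
  · by_cases hi : i ∈ S <;> by_cases hj : j ∈ S <;>
      simp [hi, hj, h.ne, h.ne', jwSign_insert, jwSign_erase, h, h.not_gt,
        Finset.erase_insert_of_ne h.ne]; ring
  · by_cases hi : i ∈ S
    · simp [hi, jwSign_erase, ← mul_assoc, key]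
    · simp [hi, jwSign_insert, ← mul_assoc, key]
  · by_cases hi : i ∈ S <;> by_cases hj : j ∈ S <;>
      simp [hi, hj, h.ne, h.ne', jwSign_insert, jwSign_erase, h, h.not_gt,
        Finset.erase_insert_of_ne h.ne']; ring

theorem stdMajorana_isHermitian {N : ℕ} (a : Mode N) : (stdMajorana a)ᴴ = stdMajorana a := by
  rcases a with i | i
  · simp [stdMajorana, conjTranspose_smul, add_comm]
  · simp only [stdMajorana, conjTranspose_smul, conjTranspose_sub, conjTranspose_conjTranspose]
    rw [← neg_sub (annihilation i), smul_neg, ← neg_smul]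
    congr 1
    simp

theorem stdMajorana_anticomm {N : ℕ} (a b : Mode N) :
    stdMajorana a * stdMajorana b + stdMajorana b * stdMajorana a =
      (1 : Matrix (Mode N) (Mode N) ℂ) a b • (1 : FockOp N) := by
  have hs : (((Real.sqrt 2 : ℝ) : ℂ)⁻¹) * (((Real.sqrt 2 : ℝ) : ℂ)⁻¹) = 1 / 2 := by
    rw [← mul_inv, ← Complex.ofReal_mul, Real.mul_self_sqrt (by norm_num)]; norm_num
  have hI : (Complex.I)⁻¹ = -Complex.I := Complex.inv_I
  have hII := Complex.I_mul_I
  have aa := fun i j : Fin N => eq_neg_of_add_eq_zero_right (annihilation_anticomm i j)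
  have cc : ∀ i j : Fin N, (annihilation j)ᴴ * (annihilation i)ᴴ =
      -((annihilation i)ᴴ * (annihilation j)ᴴ) := fun i j => by
    have := congrArg conjTranspose (aa j i)
    simpa using this
  have ac := fun i j : Fin N =>
    eq_sub_of_add_eq' (annihilation_creation_anticomm i j)
  set s := ((Real.sqrt 2 : ℝ) : ℂ)⁻¹ with hsdef
  rcases a with i | i <;> rcases b with j | j
  · simp only [stdMajorana, ← hsdef, smul_mul_smul_comm, hs, add_mul, mul_add, aa i j, cc i j,
      ac i j, ac j i]
    by_cases h : i = j
    · subst h; simp only [if_true, one_apply_eq]; module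
    · have h' : j ≠ i := fun e => h e.symm
      simp only [h, h', if_false, Matrix.one_apply, Sum.inl.injEq]; module
  · simp only [stdMajorana, ← hsdef, mul_inv, smul_mul_smul_comm, add_mul, mul_add, sub_mul,
      mul_sub, aa i j, cc i j, ac i j, ac j i]
    by_cases h : i = j
    · subst h; simp only [if_true, Matrix.one_apply, reduceCtorEq, if_false]; module
    · have h' : j ≠ i := fun e => h e.symm
      simp only [h, h', if_false, Matrix.one_apply, reduceCtorEq]; module
  · simp only [stdMajorana, ← hsdef, mul_inv, smul_mul_smul_comm, add_mul, mul_add, sub_mul,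
      mul_sub, aa i j, cc i j, ac i j, ac j i]
    by_cases h : i = j
    · subst h; simp only [if_true, Matrix.one_apply, reduceCtorEq, if_false]; module
    · have h' : j ≠ i := fun e => h e.symm
      simp only [h, h', if_false, Matrix.one_apply, reduceCtorEq]; module
  · have hp : (s * Complex.I⁻¹) * (s * Complex.I⁻¹) = -(1 / 2) := by
      rw [mul_mul_mul_comm, hs, hI, neg_mul_neg, hII]; ring
    simp only [stdMajorana, mul_inv, ← hsdef, smul_mul_smul_comm, hp, sub_mul, mul_sub, aa i j,
      cc i j, ac i j, ac j i]
    by_cases h : i = j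
    · subst h; simp only [if_true, one_apply_eq]; module
    · have h' : j ≠ i := fun e => h e.symm
      simp only [h, h', if_false, Matrix.one_apply, Sum.inr.injEq]; module

theorem majorana_isHermitian {N : ℕ} (L : Matrix (Mode N) (Mode N) ℝ) (a : Mode N) :
    (majorana L a)ᴴ = majorana L a := by
  simp [majorana, conjTranspose_sum, conjTranspose_smul, stdMajorana_isHermitian]

theorem majorana_anticomm {N : ℕ} {G L : Matrix (Mode N) (Mode N) ℝ}
    (hL : L * L.transpose = G) (a b : Mode N) :
    majorana L a * majorana L b + majorana L b * majorana L a =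
      (G a b : ℂ) • (1 : FockOp N) := by
  have h1 : majorana L b * majorana L a =
      ∑ c, ∑ d, ((L a c : ℂ) * (L b d : ℂ)) • (stdMajorana d * stdMajorana c) := by
    rw [majorana, majorana, Finset.sum_mul_sum, Finset.sum_comm]
    simp only [smul_mul_smul_comm, mul_comm]
  rw [h1, majorana, majorana, Finset.sum_mul_sum]
  simp only [smul_mul_smul_comm]
  simp only [← Finset.sum_add_distrib, ← smul_add, stdMajorana_anticomm, smul_smul,
    ← Finset.sum_smul]
  congr 1
  rw [← hL, mul_apply]
  simp [Matrix.one_apply]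

/-! ### Linear and quadratic operators, conjugation by exponentials -/

/-- The linear combinations `∑ b, X^a_b ξ^b` of the observables. -/
def linOp {N : ℕ} (L : Matrix (Mode N) (Mode N) ℝ) (X : Matrix (Mode N) (Mode N) ℂ) (a : Mode N) :
    FockOp N :=
  ∑ b, X a b • majorana L b

/-- The operator `½ A_{ab} ξ^a ξ^b`. -/
def quadOp {N : ℕ} (L : Matrix (Mode N) (Mode N) ℝ) (A : Matrix (Mode N) (Mode N) ℂ) : FockOp N :=
  (1 / 2 : ℂ) • ∑ a, ∑ b, A a b • (majorana L a * majorana L b)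

/-- A real matrix regarded as a complex one. -/
abbrev toC {ι : Type*} [Fintype ι] [DecidableEq ι] : Matrix ι ι ℝ →+* Matrix ι ι ℂ :=
  Complex.ofRealHom.mapMatrix

theorem toC_apply {ι : Type*} [Fintype ι] [DecidableEq ι] (X : Matrix ι ι ℝ) (a b : ι) :
    toC X a b = (X a b : ℂ) := rfl

theorem toC_transpose {ι : Type*} [Fintype ι] [DecidableEq ι] (X : Matrix ι ι ℝ) :
    toC Xᵀ = (toC X)ᵀ := rfl

theorem toC_smul {ι : Type*} [Fintype ι] [DecidableEq ι] (r : ℝ) (X : Matrix ι ι ℝ) :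
    toC (r • X) = (r : ℂ) • toC X := by
  ext a b; simp [toC_apply]

theorem toC_exp {ι : Type*} [Fintype ι] [DecidableEq ι] (X : Matrix ι ι ℝ) :
    toC (NormedSpace.exp X) = NormedSpace.exp (toC X) := by
  open scoped Norms.Operator in
  exact NormedSpace.map_exp toC (Continuous.matrix_map continuous_id Complex.continuous_ofReal) X

/-- If right and left multiplication by `B` differ by right multiplication by `X` on the range of
`l`, then the exponentials intertwine accordingly. -/
theorem mul_exp_eq_exp_mul_of_commutator {A M : Type*} [NormedRing A] [NormedAlgebra ℂ A]
    [CompleteSpace A] [NormedRing M] [NormedAlgebra ℂ M] [CompleteSpace M] (l : M →L[ℂ] A)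
    (B : A) (X : M) (h : ∀ Y, l Y * B = B * l Y + l (Y * X)) (Y : M) :
    l Y * NormedSpace.exp B = NormedSpace.exp B * l (Y * NormedSpace.exp X) := by
  -- The function e^{sB} l(Y e^{sX}) e^{−sB} is constant, its derivative terms cancelling by `h`;
  -- comparing s = 1 with s = 0 gives the claim.
  have hd : ∀ t : ℂ, HasDerivAt (fun s : ℂ => NormedSpace.exp (s • B) *
      l (Y * NormedSpace.exp (s • X)) * NormedSpace.exp (s • -B)) 0 t := fun t => by
    have h1 : HasDerivAt (fun s : ℂ => l (Y * NormedSpace.exp (s • X))) _ t :=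
      l.hasFDerivAt.comp_hasDerivAt t ((hasDerivAt_exp_smul_const X t).const_mul Y)
    refine (((hasDerivAt_exp_smul_const B t).fun_mul h1).fun_mul
      (hasDerivAt_exp_smul_const' (-B) t)).congr_deriv ?_
    have := eq_sub_of_add_eq' (h (Y * NormedSpace.exp (t • X))).symm
    rw [← mul_assoc Y, this]
    noncomm_ring
  have hc := is_const_of_deriv_eq_zero (fun t => (hd t).differentiableAt)
    (fun t => (hd t).deriv) 1 0
  have hB : NormedSpace.exp (-B) * NormedSpace.exp B = 1 := by
    let : NormedAlgebra ℚ A := NormedAlgebra.restrictScalars ℚ ℂ A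
    rw [← NormedSpace.exp_add_of_commute (Commute.neg_left (Commute.refl B)), neg_add_cancel,
      NormedSpace.exp_zero]
  simp only [one_smul, zero_smul, NormedSpace.exp_zero, mul_one, one_mul] at hc
  rw [← hc, mul_assoc, hB, mul_one]

section

variable {N : ℕ} {G L : Matrix (Mode N) (Mode N) ℝ}

theorem quadraticOp_eq_quadOp (K : Matrix (Mode N) (Mode N) ℝ) :
    quadraticOp G L K = quadOp L (toC (G⁻¹ * K)) := rfl

theorem linOp_add (X Y : Matrix (Mode N) (Mode N) ℂ) (a : Mode N) :
    linOp L (X + Y) a = linOp L X a + linOp L Y a := by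
  simp [linOp, add_smul, Finset.sum_add_distrib]

theorem linOp_mul (X Y : Matrix (Mode N) (Mode N) ℂ) (a : Mode N) :
    linOp L (X * Y) a = ∑ b, X a b • linOp L Y b := by
  simp only [linOp, mul_apply, Finset.sum_smul, Finset.smul_sum, smul_smul]
  exact Finset.sum_comm

theorem quadOp_smul (r : ℂ) (A : Matrix (Mode N) (Mode N) ℂ) :
    quadOp L (r • A) = r • quadOp L A := by
  simp only [quadOp, Matrix.smul_apply, smul_eq_mul, mul_smul, ← Finset.smul_sum]
  rw [smul_comm]

/-- Lets a coefficient matrix flanked by projections be read as a quadratic form in the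
annihilators, both for nilpotency and for the vanishing of B on ψ. -/
theorem quadOp_conj (P Q A : Matrix (Mode N) (Mode N) ℂ) :
    quadOp L (Pᵀ * A * Q) = (1 / 2 : ℂ) • ∑ a, ∑ b, A a b • (linOp L P a * linOp L Q b) := by
  have : ∀ a b, (Pᵀ * A * Q) a b = ∑ c, ∑ d, A c d * (P c a * Q d b) := fun a b => by
    simp only [mul_apply, Finset.sum_mul, transpose_apply]
    rw [Finset.sum_comm]
    exact Finset.sum_congr rfl fun c _ => Finset.sum_congr rfl fun d _ => by ring
  rw [quadOp]
  congr 1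
  simp only [this, linOp, Finset.sum_mul_sum, smul_mul_smul_comm, Finset.smul_sum,
    Finset.sum_smul, smul_smul]
  rw [Finset.sum_congr rfl fun a _ => Finset.sum_comm]
  rw [Finset.sum_comm]
  refine Finset.sum_congr rfl fun c _ => ?_
  rw [Finset.sum_congr rfl fun a _ => Finset.sum_comm]
  rw [Finset.sum_comm]

theorem linOp_anticomm (hL : L * L.transpose = G) (X Y : Matrix (Mode N) (Mode N) ℂ)
    (a b : Mode N) :
    linOp L X a * linOp L Y b + linOp L Y b * linOp L X a =
      (X * toC G * Yᵀ) a b • (1 : FockOp N) := by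
  have h1 : linOp L Y b * linOp L X a =
      ∑ c, ∑ d, (X a c * Y b d) • (majorana L d * majorana L c) := by
    rw [linOp, linOp, Finset.sum_mul_sum, Finset.sum_comm]
    simp only [smul_mul_smul_comm, mul_comm]
  rw [h1, linOp, linOp, Finset.sum_mul_sum]
  simp only [smul_mul_smul_comm, ← Finset.sum_add_distrib, ← smul_add, majorana_anticomm hL,
    smul_smul, ← Finset.sum_smul]
  congr 1
  simp only [mul_apply, Finset.sum_mul, toC_apply, transpose_apply]
  rw [Finset.sum_comm]
  exact Finset.sum_congr rfl fun c _ => Finset.sum_congr rfl fun d _ => by ring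

/-- Moving ξ^c through ξ^a ξ^b produces two contractions with opposite signs. As g X is
antisymmetric they add up instead of cancelling, and the factor ½ absorbs the doubling. -/
theorem majorana_mul_quadOp (hG : IsUnit G) (hL : L * L.transpose = G)
    {X : Matrix (Mode N) (Mode N) ℂ} (hX : X * toC G = -(toC G * Xᵀ)) (c : Mode N) :
    majorana L c * quadOp L (toC G⁻¹ * X) = quadOp L (toC G⁻¹ * X) * majorana L c + linOp L X c := by
  have hGs : (toC G)ᵀ = toC G := by
    rw [← toC_transpose, ← hL, transpose_mul, transpose_transpose]
  have hGG : toC G * toC G⁻¹ = 1 := by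
    rw [← map_mul, mul_nonsing_inv _ ((isUnit_iff_isUnit_det _).1 hG), map_one]
  have hGG' : toC G⁻¹ * toC G = 1 := by
    rw [← map_mul, nonsing_inv_mul _ ((isUnit_iff_isUnit_det _).1 hG), map_one]
  have hgs : (toC G⁻¹)ᵀ = toC G⁻¹ := by
    rw [← toC_transpose, transpose_nonsing_inv, ← hL, transpose_mul, transpose_transpose]
  set A := toC G⁻¹ * X with hA
  have hAX : toC G * A = X := by rw [hA, ← mul_assoc, hGG, one_mul]
  have hAs : Aᵀ = -A := by
    have : toC G⁻¹ * (X * toC G) * toC G⁻¹ = -(toC G⁻¹ * (toC G * Xᵀ) * toC G⁻¹) := by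
      rw [hX, mul_neg, neg_mul]
    rw [mul_assoc, mul_assoc, hGG, mul_one, ← mul_assoc (toC G⁻¹) (toC G), hGG', one_mul] at this
    rw [hA, transpose_mul, hgs, this, neg_neg]
  have key : ∀ a b, majorana L c * (majorana L a * majorana L b) =
      majorana L a * majorana L b * majorana L c + (G c a : ℂ) • majorana L b
        - (G c b : ℂ) • majorana L a := fun a b => by
    have e1 := eq_sub_of_add_eq (majorana_anticomm hL c a)
    have e2 := eq_sub_of_add_eq (majorana_anticomm hL c b)
    rw [← mul_assoc, e1, sub_mul, mul_assoc _ _ (majorana L b), e2, mul_sub, smul_mul_assoc,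
      one_mul, mul_smul_comm, mul_one, ← mul_assoc]
    abel
  have s1 : ∑ a, ∑ b, (A a b * (G c a : ℂ)) • majorana L b = linOp L X c := by
    rw [Finset.sum_comm, linOp]
    refine Finset.sum_congr rfl fun b _ => ?_
    rw [← Finset.sum_smul, ← hAX, mul_apply]
    congr 1
    exact Finset.sum_congr rfl fun a _ => by rw [mul_comm, toC_apply]
  have s2 : ∑ a, ∑ b, (A a b * (G c b : ℂ)) • majorana L a = -linOp L X c := by
    rw [linOp, ← Finset.sum_neg_distrib]
    refine Finset.sum_congr rfl fun a _ => ?_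
    rw [← Finset.sum_smul, ← neg_smul, ← hAX, mul_apply, ← Finset.sum_neg_distrib]
    congr 1
    refine Finset.sum_congr rfl fun b _ => ?_
    have : A a b = -A b a := congrFun (congrFun hAs b) a
    rw [this, toC_apply]; ring
  rw [quadOp, mul_smul_comm, smul_mul_assoc, Finset.mul_sum, Finset.sum_mul]
  simp only [Finset.mul_sum, Finset.sum_mul, mul_smul_comm, smul_mul_assoc, key, smul_sub,
    smul_add, Finset.sum_add_distrib, Finset.sum_sub_distrib, smul_smul, s1, s2]
  module

/-- The observables transform linearly under conjugation by the exponential of a quadratic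
operator. -/
theorem linOp_mul_exp_quadOp (hG : IsUnit G) (hL : L * L.transpose = G)
    {X : Matrix (Mode N) (Mode N) ℂ} (hX : X * toC G = -(toC G * Xᵀ))
    (Y : Matrix (Mode N) (Mode N) ℂ) (a : Mode N) :
    linOp L Y a * NormedSpace.exp (quadOp L (toC G⁻¹ * X)) =
      NormedSpace.exp (quadOp L (toC G⁻¹ * X)) * linOp L (Y * NormedSpace.exp X) a := by
  open scoped Norms.Operator in
  let l : Matrix (Mode N) (Mode N) ℂ →ₗ[ℂ] FockOp N :=
    { toFun := fun Y => linOp L Y a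
      map_add' := fun Y Y' => linOp_add Y Y' a
      map_smul' := fun c Y => by
        simp [linOp, Finset.smul_sum, smul_smul] }
  refine mul_exp_eq_exp_mul_of_commutator (LinearMap.toContinuousLinearMap l) _ X (fun Y => ?_) Y
  change linOp L Y a * _ = _ * linOp L Y a + linOp L (Y * X) a
  rw [linOp_mul Y X]
  simp only [linOp.eq_1 (X := Y), Finset.sum_mul, Finset.mul_sum, smul_mul_assoc, mul_smul_comm,
    majorana_mul_quadOp hG hL hX, smul_add, Finset.sum_add_distrib]

/-- Quadratic operators in mutually anticommuting linear observables are nilpotent. -/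
theorem isNilpotent_quadOp (hL : L * L.transpose = G) {P : Matrix (Mode N) (Mode N) ℂ}
    (hP : P * toC G * Pᵀ = 0) (A : Matrix (Mode N) (Mode N) ℂ) :
    IsNilpotent (quadOp L (Pᵀ * A * P)) := by
  have hac : ∀ a b, linOp L P b * linOp L P a = -(linOp L P a * linOp L P b) := fun a b => by
    have := linOp_anticomm hL P P a b
    rw [hP, Matrix.zero_apply, zero_smul] at this
    exact eq_neg_of_add_eq_zero_right this
  have hsq : ∀ a, linOp L P a * linOp L P a = 0 := fun a => by
    have h := eq_neg_iff_add_eq_zero.1 (hac a a)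
    rw [← two_smul ℂ] at h
    exact (smul_eq_zero.1 h).resolve_left two_ne_zero
  have hcomm : ∀ a b c d, Commute (linOp L P a * linOp L P b) (linOp L P c * linOp L P d) := by
    have h : ∀ a b c, Commute (linOp L P a * linOp L P b) (linOp L P c) := fun a b c => by
      rw [commute_iff_eq, mul_assoc, hac c b, mul_neg, ← mul_assoc, hac c a, neg_mul, neg_neg,
        mul_assoc]
    exact fun a b c d => (h a b c).mul_right (h a b d)
  rw [quadOp_conj, Finset.smul_sum]
  simp only [Finset.smul_sum, smul_smul]
  rw [← Finset.sum_product']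
  -- Products of two anticommuting, square-zero operators commute with each other and square to
  -- zero, so the whole sum is nilpotent.
  refine Commute.isNilpotent_sum (fun x _ => ⟨2, ?_⟩) fun x y _ _ => ?_
  · have h : (linOp L P x.1 * linOp L P x.2) ^ 2 = 0 := by
      rw [pow_two, mul_assoc, ← mul_assoc _ (linOp L P x.1), hac x.1 x.2, neg_mul,
        mul_neg, mul_assoc, hsq, mul_zero, mul_zero, neg_zero]
    rw [smul_pow, h, smul_zero]
  · exact ((hcomm _ _ _ _).smul_left _).smul_right _

end

/-! ### Polynomial square roots of determinants, logarithmic derivatives -/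

open Polynomial in
/-- If the square of a polynomial agrees with `c² det (1 - t W)` near the origin, then its value
at `1` is determined, including the sign, by the paired eigenvalues of `1 - W`. -/
theorem exists_paired_roots {n : Type*} [Fintype n] [DecidableEq n] (W : Matrix n n ℂ)
    (F : ℂ[X]) {ε : ℝ} (hε : 0 < ε) (h0 : F.eval 0 ≠ 0)
    (hF : ∀ t : ℝ, |t| < ε → F.eval (t : ℂ) ^ 2 = F.eval 0 ^ 2 * (1 - (t : ℂ) • W).det) :
    ∃ (s : Multiset ℂ) (k : ℕ), (1 - W).charpoly.roots + Multiset.replicate k 1 = 2 • s ∧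
      F.eval 1 = F.eval 0 * s.prod := by
  set c := F.eval 0 with hc
  set M := max F.natDegree (Fintype.card n) with hM
  have hMF : F.natDegree < M + 1 := Nat.lt_succ_of_le (le_max_left _ _)
  have hMn : Fintype.card n ≤ M := le_max_right _ _
  -- This is (x − 1)^M F(t) with t = −1/(x − 1), the substitution that turns det(1 − tW) into the
  -- characteristic polynomial of 1 − W. The point x = 0 corresponds to t = 1, and the leading
  -- coefficient records F(0).
  set h : ℂ[X] := ∑ k ∈ Finset.range (M + 1), C (F.coeff k * (-1) ^ k) * (X - C 1) ^ (M - k) with hh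
  have heval : ∀ x : ℂ, x - 1 ≠ 0 → h.eval x = (x - 1) ^ M * F.eval (-(x - 1)⁻¹) := by
    intro x hx
    rw [hh, eval_finsetSum, eval_eq_sum_range' hMF, Finset.mul_sum]
    refine Finset.sum_congr rfl fun k hk => ?_
    have hk' : k ≤ M := Nat.lt_succ_iff.1 (Finset.mem_range.1 hk)
    simp only [eval_mul, eval_C, eval_pow, eval_sub, eval_X]
    rw [← Nat.sub_add_cancel hk', pow_add, Nat.add_sub_cancel, neg_pow (x - 1)⁻¹, inv_pow]
    field_simp
  have hchar : ∀ x : ℂ, x - 1 ≠ 0 → (1 - W).charpoly.eval x =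
      (x - 1) ^ Fintype.card n * (1 - (-(x - 1)⁻¹) • W).det := by
    intro x hx
    rw [Matrix.eval_charpoly, ← det_smul]
    congr 1
    rw [smul_sub, smul_smul, mul_neg, mul_inv_cancel₀ hx, scalar_apply, ← smul_one_eq_diagonal,
      sub_smul]
    simp only [neg_smul, one_smul]
    abel
  have hsq : h ^ 2 = C (c ^ 2) * (X - C 1) ^ (2 * M - Fintype.card n) * (1 - W).charpoly := by
    refine Polynomial.eq_of_infinite_eval_eq _ _ ?_
    -- The sample points x = 1 + y with y = 1/ε + 1 + m give t = −1/y, which lies within the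
    -- interval where `hF` applies.
    refine (Set.infinite_of_injective_forall_mem
      (f := fun m : ℕ => (1 : ℂ) + ((ε⁻¹ + 1 + m : ℝ) : ℂ)) ?_ ?_)
    · intro a b hab
      simpa using hab
    · intro m
      have hpos : 0 < ε⁻¹ + 1 + m := by positivity
      set y : ℝ := ε⁻¹ + 1 + m with hy
      have hx : (1 + (y : ℂ)) - 1 ≠ 0 := by
        rw [add_sub_cancel_left]; exact_mod_cast hpos.ne'
      have hx' : -((1 + (y : ℂ)) - 1)⁻¹ = ((-y⁻¹ : ℝ) : ℂ) := by
        rw [add_sub_cancel_left]; push_cast; rfl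
      have hlt : |-y⁻¹| < ε := by
        rw [abs_neg, abs_of_pos (inv_pos.2 hpos)]
        refine inv_lt_of_inv_lt₀ hε ?_
        rw [hy]
        have : (0 : ℝ) ≤ m := Nat.cast_nonneg m
        linarith
      change (h ^ 2).eval _ = _
      simp only [eval_mul, eval_pow, eval_sub, eval_X, eval_C]
      rw [heval _ hx, hchar _ hx, hx', mul_pow, hF _ hlt, ← pow_mul, mul_comm M 2]
      have : ((1 + (y : ℂ)) - 1) ^ (2 * M) = ((1 + (y : ℂ)) - 1) ^ (2 * M - Fintype.card n) *
          ((1 + (y : ℂ)) - 1) ^ Fintype.card n := by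
        rw [← pow_add]; congr 1; omega
      rw [this]; ring
  have hmon : ((X - C 1 : ℂ[X]) ^ (2 * M - Fintype.card n) * (1 - W).charpoly).Monic :=
    ((monic_X_sub_C 1).pow _).mul (charpoly_monic _)
  have hc2 : c ^ 2 ≠ 0 := pow_ne_zero 2 h0
  rw [mul_assoc] at hsq
  have hdeg : h.natDegree = M := by
    have := congrArg natDegree hsq
    rw [natDegree_pow, natDegree_C_mul hc2, ((monic_X_sub_C 1).pow _).natDegree_mul
      (charpoly_monic _), natDegree_pow, natDegree_X_sub_C, charpoly_natDegree_eq_dim] at this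
    omega
  have hlead : h.leadingCoeff = c := by
    rw [leadingCoeff, hdeg, hh, finsetSum_coeff, Finset.sum_range_succ', Finset.sum_eq_zero,
      zero_add, coeff_C_mul, Nat.sub_zero]
    · have : ((X - C 1 : ℂ[X]) ^ M).coeff M = 1 := by
        have := ((monic_X_sub_C (1 : ℂ)).pow M).coeff_natDegree
        rwa [natDegree_pow, natDegree_X_sub_C, mul_one] at this
      rw [this, hc, coeff_zero_eq_eval_zero]; simp
    · intro k hk
      rw [coeff_C_mul, coeff_eq_zero_of_natDegree_lt (n := M), mul_zero]
      rw [natDegree_pow, natDegree_X_sub_C]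
      have := Finset.mem_range.1 hk
      omega
  have hspl : h.Splits := IsAlgClosed.splits h
  -- The extra roots equal to 1 come from padding the degree to M ≥ max(deg F, n). They change
  -- neither the product nor the sum of arguments.
  refine ⟨h.roots, 2 * M - Fintype.card n, ?_, ?_⟩
  · have := congrArg roots hsq
    rw [roots_pow, roots_C_mul _ hc2, roots_mul hmon.ne_zero, roots_pow, roots_X_sub_C,
      Multiset.nsmul_singleton] at this
    rw [this, add_comm]
  · have h1 : h.eval 0 = (-1) ^ M * F.eval 1 := by
      rw [heval 0 (by norm_num)]
      norm_num
    have h2 : h.eval 0 = (-1) ^ M * (c * h.roots.prod) := by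
      conv_lhs => rw [hspl.eq_prod_roots]
      rw [eval_mul, eval_C, hlead, eval_multiset_prod, Multiset.map_map]
      have : (Multiset.map ((fun p => eval 0 p) ∘ fun a => X - C a) h.roots) =
          h.roots.map Neg.neg := by
        refine Multiset.map_congr rfl fun a _ => by simp
      rw [this, Multiset.prod_map_neg, ← hspl.natDegree_eq_card_roots, hdeg]
      ring
    exact mul_left_cancel₀ (pow_ne_zero M (by norm_num)) (h1.symm.trans h2)

theorem arg_multiset_prod (s : Multiset ℂ) (hs : (0 : ℂ) ∉ s) :
    ((Complex.arg s.prod : ℝ) : Real.Angle) = ((s.map Complex.arg).sum : ℝ) := by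
  induction s using Multiset.induction_on with
  | empty => simp
  | cons a s ih =>
    rw [Multiset.mem_cons, not_or] at hs
    rw [Multiset.prod_cons, Multiset.map_cons, Multiset.sum_cons, Real.Angle.coe_add, ← ih hs.2]
    exact Complex.arg_mul_coe_angle (Ne.symm hs.1) (Multiset.prod_ne_zero hs.2)

/-- Jacobi's formula along the line `1 - t W`. -/
theorem hasDerivAt_det_one_sub_smul {n : Type*} [Fintype n] [DecidableEq n] (W S : Matrix n n ℂ)
    (t : ℝ) (hS : S * (1 - (t : ℂ) • W) = 1) :
    HasDerivAt (fun s : ℝ => (1 - (s : ℂ) • W).det)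
      (-((1 - (t : ℂ) • W).det * (S * W).trace)) t := by
  have hS' := mul_eq_one_comm.1 hS
  -- Factor 1 − sW = (1 − tW)(1 + (t − s)SW) and expand the second determinant to first order in t −
  -- s.
  have h : ∀ s : ℝ, (1 - (s : ℂ) • W).det = (1 - (t : ℂ) • W).det *
      (1 + (S * W).trace * ((t : ℂ) - s) +
        ((1 + (Polynomial.X : Polynomial ℂ) • (S * W).map Polynomial.C).det).divX.divX.eval
          ((t : ℂ) - s) * ((t : ℂ) - s) ^ 2) := fun s => by
    rw [← det_one_add_smul, ← det_mul, mul_add, mul_one, mul_smul_comm, ← mul_assoc, hS', one_mul]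
    congr 1
    module
  have hs : HasDerivAt (fun s : ℝ => (t : ℂ) - s) (-1) t :=
    (Complex.ofRealCLM.hasDerivAt (x := t)).const_sub (t : ℂ)
  set D := ((1 + (Polynomial.X : Polynomial ℂ) • (S * W).map Polynomial.C).det).divX.divX
  have hD : HasDerivAt (fun s : ℝ => D.eval ((t : ℂ) - s)) _ t :=
    (D.hasDerivAt ((t : ℂ) - t)).comp_of_eq t hs rfl
  rw [show (fun s : ℝ => (1 - (s : ℂ) • W).det) = _ from funext h]
  refine ((((hs.const_mul _).const_add 1).fun_add (hD.fun_mul (hs.fun_pow 2))).const_mul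
    _).congr_deriv ?_
  simp

/-- Two functions with proportional logarithmic derivatives. -/
theorem sq_eq_of_logDeriv {f p f' p' : ℝ → ℂ} {ε : ℝ} (hε : 0 < ε)
    (hf : ∀ t, |t| < ε → HasDerivAt f (f' t) t) (hp : ∀ t, |t| < ε → HasDerivAt p (p' t) t)
    (hp0 : ∀ t, |t| < ε → p t ≠ 0) (h1 : p 0 = 1)
    (h : ∀ t, |t| < ε → 2 * f' t * p t = f t * p' t) (t : ℝ) (ht : |t| < ε) :
    f t ^ 2 = f 0 ^ 2 * p t := by
  have hd : ∀ t, |t| < ε → HasDerivAt (fun s => f s ^ 2 / p s) 0 t := fun t ht => by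
    refine (((hf t ht).fun_pow 2).fun_div (hp t ht) (hp0 t ht)).congr_deriv ?_
    rw [div_eq_zero_iff]; left
    have := h t ht
    simp only [Nat.cast_ofNat, Nat.add_one_sub_one, pow_one]
    linear_combination (f t) * this
  have hb : ∀ t, t ∈ Metric.ball (0 : ℝ) ε ↔ |t| < ε := fun t => by
    rw [Metric.mem_ball, Real.dist_eq, sub_zero]
  have := Metric.isOpen_ball.is_const_of_deriv_eq_zero (convex_ball (0 : ℝ) ε).isPreconnected
    (f := fun s => f s ^ 2 / p s)
    (fun s hs => (hd s ((hb s).1 hs)).differentiableAt.differentiableWithinAt)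
    (fun s hs => (hd s ((hb s).1 hs)).deriv) ((hb t).2 ht) (Metric.mem_ball_self hε)
  simp only [h1, div_one] at this
  rw [← this, div_mul_cancel₀ _ (hp0 t ht)]

/-! ### Phase space as a complex vector space: linear maps and traces -/

namespace ComplexStructure

variable {ι : Type*} [Fintype ι] [DecidableEq ι] {G : Matrix ι ι ℝ} (J : ComplexStructure G)

theorem linPart_of_commute {X : Matrix ι ι ℝ} (hX : Commute X J.mat) : J.linPart X = X := by
  rw [linPart, ← hX.eq, mul_assoc, J.sq, mul_neg_one, sub_neg_eq_add, ← two_smul ℝ, smul_smul]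
  norm_num

theorem toComplex_apply {X : Matrix ι ι ℝ} (hX : Commute X J.mat) (v : J.Space) :
    J.toComplex X v = J.act X v := by
  change J.act (J.linPart X) v = _
  rw [J.linPart_of_commute hX]

theorem toComplex_mul {X Y : Matrix ι ι ℝ} (hX : Commute X J.mat) (hY : Commute Y J.mat) :
    J.toComplex (X * Y) = J.toComplex X * J.toComplex Y := by
  ext v
  rw [Module.End.mul_apply, toComplex_apply J hX, toComplex_apply J hY,
    toComplex_apply J (hX.mul_left hY), act_act]

theorem toComplex_one : J.toComplex 1 = 1 := by
  ext v
  rw [toComplex_apply J (Commute.one_left _)]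
  exact Matrix.one_mulVec v

theorem toComplex_sub {X Y : Matrix ι ι ℝ} (hX : Commute X J.mat) (hY : Commute Y J.mat) :
    J.toComplex (X - Y) = J.toComplex X - J.toComplex Y := by
  ext v
  rw [LinearMap.sub_apply, toComplex_apply J hX, toComplex_apply J hY,
    toComplex_apply J (hX.sub_left hY)]
  exact Matrix.sub_mulVec X Y v

theorem toComplex_smul {X : Matrix ι ι ℝ} (hX : Commute X J.mat) (r : ℝ) :
    J.toComplex (r • X) = (r : ℂ) • J.toComplex X := by
  ext v
  rw [LinearMap.smul_apply, toComplex_apply J hX, toComplex_apply J (hX.smul_left r), smul_def,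
    Complex.ofReal_re, Complex.ofReal_im, zero_smul, add_zero]
  exact Matrix.smul_mulVec r X v

theorem toComplex_mat : J.toComplex J.mat = Complex.I • 1 := by
  ext v
  rw [toComplex_apply J (Commute.refl _), LinearMap.smul_apply, smul_def]
  simp

end ComplexStructure

/-- In the real basis {1, i} times a complex basis, a diagonal entry z becomes a 2 × 2 block of
trace 2 Re z. -/
theorem _root_.LinearMap.trace_restrictScalars_complex {V : Type*} [AddCommGroup V] [Module ℂ V]
    [Module ℝ V] [IsScalarTower ℝ ℂ V] [Module.Finite ℂ V] (f : V →ₗ[ℂ] V) :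
    LinearMap.trace ℝ V (f.restrictScalars ℝ) = 2 * (LinearMap.trace ℂ V f).re := by
  classical
  let b := Module.finBasis ℂ V
  rw [LinearMap.trace_eq_matrix_trace ℝ (Complex.basisOneI.smulTower b),
    LinearMap.trace_eq_matrix_trace ℂ b, Matrix.trace, Matrix.trace, Fintype.sum_prod_type,
    Fin.sum_univ_two, Complex.re_sum, ← Finset.sum_add_distrib, Finset.mul_sum]
  refine Finset.sum_congr rfl fun i _ => ?_
  simp only [diag_apply, LinearMap.toMatrix_apply, LinearMap.restrictScalars_apply,
    Module.Basis.smulTower_repr_mk, Module.Basis.smulTower_apply, map_smul,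
    Complex.coe_basisOneI]
  simp
  ring

/-- The real trace of X sees only the real part of the complex trace. Since J acts as i, the real
trace of XJ supplies the imaginary part. -/
theorem ComplexStructure.trace_toComplex {ι : Type*} [Fintype ι] [DecidableEq ι]
    {G : Matrix ι ι ℝ} (J : ComplexStructure G) {X : Matrix ι ι ℝ} (hX : Commute X J.mat) :
    LinearMap.trace ℂ J.Space (J.toComplex X) =
      (1 / 2 : ℂ) * (X.trace - Complex.I * (X * J.mat).trace) := by
  have hr : ∀ Y : Matrix ι ι ℝ, Commute Y J.mat →
      2 * (LinearMap.trace ℂ J.Space (J.toComplex Y)).re = Y.trace := fun Y hY => by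
    rw [← LinearMap.trace_restrictScalars_complex]
    have : ((J.toComplex Y).restrictScalars ℝ : J.Space →ₗ[ℝ] J.Space) =
        (Matrix.toLin' Y : (ι → ℝ) →ₗ[ℝ] (ι → ℝ)) :=
      LinearMap.ext fun v => J.toComplex_apply hY v
    rw [this]
    exact Matrix.trace_toLin'_eq Y
  have h1 := hr X hX
  have h2 := hr (X * J.mat) (hX.mul_left (Commute.refl _))
  rw [J.toComplex_mul hX (Commute.refl _), J.toComplex_mat, mul_smul_comm, mul_one,
    map_smul, smul_eq_mul, Complex.I_mul_re] at h2
  rw [← h1, ← h2]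
  apply Complex.ext <;> simp

/-! ### Eigenprojections of J, linear and antilinear parts, the overlap trace -/

namespace ComplexStructure

variable {ι : Type*} [Fintype ι] [DecidableEq ι] {G : Matrix ι ι ℝ} (J : ComplexStructure G)

/-- The projection `½ (1 + i J)`. -/
def projP : Matrix ι ι ℂ := (1 / 2 : ℂ) • (1 + Complex.I • toC J.mat)

/-- The projection `½ (1 - i J)`. -/
def projQ : Matrix ι ι ℂ := (1 / 2 : ℂ) • (1 - Complex.I • toC J.mat)

theorem toC_sq : toC J.mat * toC J.mat = -1 := by
  rw [← map_mul, J.sq, map_neg, map_one]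

theorem projP_add_projQ : J.projP + J.projQ = 1 := by
  rw [projP, projQ]; module

theorem projQ_mul_projP : J.projQ * J.projP = 0 := by
  rw [projP, projQ, smul_mul_smul_comm, mul_add, mul_one, sub_mul, one_mul, smul_mul_smul_comm,
    toC_sq, Complex.I_mul_I]
  module

theorem projP_mul_projQ : J.projP * J.projQ = 0 := by
  rw [projP, projQ, smul_mul_smul_comm, mul_sub, mul_one, add_mul, one_mul, smul_mul_smul_comm,
    toC_sq, Complex.I_mul_I]
  module

theorem projP_mul_self : J.projP * J.projP = J.projP := by
  conv_rhs => rw [← one_mul J.projP, ← J.projP_add_projQ, add_mul, projQ_mul_projP, add_zero]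

theorem mat_mul_metric : J.mat * G = -(G * J.matᵀ) := by
  have h := congrArg (J.mat * ·) J.compat
  simp only [← mul_assoc, J.sq] at h
  rw [← h, neg_one_mul, neg_mul]

/-- JG is antisymmetric, so transposing across the metric replaces J by −J and interchanges the two
projections. -/
theorem metric_mul_projP_transpose : toC G * J.projPᵀ = J.projQ * toC G := by
  have h : toC J.mat * toC G = -(toC G * (toC J.mat)ᵀ) := by
    rw [← map_mul, mat_mul_metric, map_neg, map_mul]; rfl
  rw [projP, projQ, transpose_smul, transpose_add, transpose_one, transpose_smul, mul_smul_comm,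
    smul_mul_assoc, mul_add, sub_mul, mul_smul_comm, smul_mul_assoc, h, mul_one, one_mul]
  module

theorem metric_mul_projQ_transpose : toC G * J.projQᵀ = J.projP * toC G := by
  have h1 : J.projQ = 1 - J.projP := eq_sub_of_add_eq' J.projP_add_projQ
  have h2 : J.projP = 1 - J.projQ := eq_sub_of_add_eq J.projP_add_projQ
  rw [h1, transpose_sub, transpose_one, mul_sub, mul_one, metric_mul_projP_transpose, h2, sub_mul,
    one_mul]

/-- The range of P is isotropic for the metric: the annihilators of a Gaussian state anticommute
with one another. -/
theorem projP_mul_metric_mul_projP_transpose : J.projP * toC G * J.projPᵀ = 0 := by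
  rw [mul_assoc, metric_mul_projP_transpose, ← mul_assoc, projP_mul_projQ, zero_mul]

theorem projP_transpose_mul_inv (hG : IsUnit G) :
    J.projPᵀ * toC G⁻¹ = toC G⁻¹ * J.projQ := by
  have hGG : toC G * toC G⁻¹ = 1 := by
    rw [← map_mul, mul_nonsing_inv _ ((isUnit_iff_isUnit_det _).1 hG), map_one]
  have hGG' : toC G⁻¹ * toC G = 1 := mul_eq_one_comm.1 hGG
  rw [← one_mul (J.projPᵀ), ← hGG', mul_assoc _ (toC G), metric_mul_projP_transpose, mul_assoc,
    mul_assoc, hGG, mul_one]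

theorem linPart_commute (M : Matrix ι ι ℝ) : Commute (J.linPart M) J.mat :=
  (J.mat_mul_linPart M).symm

theorem antilinPart_mul_mat (M : Matrix ι ι ℝ) :
    J.antilinPart M * J.mat = -(J.mat * J.antilinPart M) := by
  have h1 : J.mat * (J.mat * M * J.mat) = -(M * J.mat) := by
    rw [← mul_assoc, ← mul_assoc, J.sq, neg_one_mul, neg_mul]
  have h2 : J.mat * M * J.mat * J.mat = -(J.mat * M) := by
    rw [mul_assoc, J.sq, mul_neg_one]
  rw [antilinPart, mul_smul_comm, smul_mul_assoc, mul_add, add_mul, h1, h2]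
  module

theorem linPart_add_antilinPart (M : Matrix ι ι ℝ) : J.linPart M + J.antilinPart M = M := by
  rw [linPart, antilinPart]; module

theorem commute_inv {X : Matrix ι ι ℝ} (hX : Commute X J.mat) : Commute X⁻¹ J.mat := by
  by_cases h : IsUnit X
  · obtain ⟨u, rfl⟩ := h
    rw [← coe_units_inv]
    exact hX.units_inv_left
  · rw [nonsing_inv_apply_not_isUnit _ (fun h' => h ((isUnit_iff_isUnit_det _).2 h'))]
    exact Commute.zero_left _

theorem zPart_mul_mat (M : Matrix ι ι ℝ) :
    J.zPart M * J.mat = -(J.mat * J.zPart M) := by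
  rw [zPart, mul_assoc, antilinPart_mul_mat, mul_neg, ← mul_assoc,
    (J.commute_inv (J.linPart_commute M)).eq, mul_assoc]

theorem commute_mul_of_anticomm {X Y : Matrix ι ι ℝ} (hX : X * J.mat = -(J.mat * X))
    (hY : Y * J.mat = -(J.mat * Y)) : Commute (X * Y) J.mat := by
  rw [commute_iff_eq, mul_assoc, hY, mul_neg, ← mul_assoc, hX, neg_mul, neg_neg, mul_assoc]

theorem toC_commute_projP {X : Matrix ι ι ℝ} (hX : Commute X J.mat) :
    toC X * J.projP = J.projP * toC X := by
  have : toC X * toC J.mat = toC J.mat * toC X := by rw [← map_mul, hX.eq, map_mul]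
  rw [projP, mul_smul_comm, smul_mul_assoc, mul_add, add_mul, mul_smul_comm, smul_mul_assoc, this,
    mul_one, one_mul]

theorem toC_commute_projQ {X : Matrix ι ι ℝ} (hX : Commute X J.mat) :
    toC X * J.projQ = J.projQ * toC X := by
  have h1 : J.projQ = 1 - J.projP := eq_sub_of_add_eq' J.projP_add_projQ
  rw [h1, mul_sub, sub_mul, J.toC_commute_projP hX, mul_one, one_mul]

theorem toC_anticomm_projP {X : Matrix ι ι ℝ} (hX : X * J.mat = -(J.mat * X)) :
    toC X * J.projP = J.projQ * toC X := by
  have : toC X * toC J.mat = -(toC J.mat * toC X) := by rw [← map_mul, hX, map_neg, map_mul]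
  rw [projP, projQ, mul_smul_comm, smul_mul_assoc, mul_add, sub_mul, mul_smul_comm,
    smul_mul_assoc, this, mul_one, one_mul]
  module

theorem toC_anticomm_projQ {X : Matrix ι ι ℝ} (hX : X * J.mat = -(J.mat * X)) :
    toC X * J.projQ = J.projP * toC X := by
  have h1 : J.projQ = 1 - J.projP := eq_sub_of_add_eq' J.projP_add_projQ
  have h2 : J.projP = 1 - J.projQ := eq_sub_of_add_eq J.projP_add_projQ
  rw [h1, mul_sub, J.toC_anticomm_projP hX, h2, sub_mul, mul_one, one_mul]

theorem projP_mul_toC (M : Matrix ι ι ℝ) :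
    J.projP * toC M = toC (J.linPart M) * J.projP + toC (J.antilinPart M) * J.projQ := by
  conv_lhs => rw [← J.linPart_add_antilinPart M, map_add, mul_add]
  rw [J.toC_commute_projP (J.linPart_commute M), J.toC_anticomm_projQ (J.antilinPart_mul_mat M)]

theorem projQ_mul_toC (M : Matrix ι ι ℝ) :
    J.projQ * toC M = toC (J.linPart M) * J.projQ + toC (J.antilinPart M) * J.projP := by
  conv_lhs => rw [← J.linPart_add_antilinPart M, map_add, mul_add]
  rw [J.toC_commute_projQ (J.linPart_commute M), J.toC_anticomm_projP (J.antilinPart_mul_mat M)]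

theorem linPart_mul_zPart {M : Matrix ι ι ℝ} (hM : IsUnit (J.linPart M)) :
    J.linPart M * J.zPart M = J.antilinPart M := by
  rw [zPart, ← mul_assoc, mul_nonsing_inv _ ((isUnit_iff_isUnit_det _).1 hM), one_mul]

/-- Both M and JMJ preserve G; the difference of the two identities is CGDᵀ + DGCᵀ = 0, and writing
D = CZ lets C be cancelled on both sides. So Z is an infinitesimal rotation and may serve as a
quadratic generator. -/
theorem zPart_mul_metric {M : Matrix ι ι ℝ} (hM : IsUnit (J.linPart M)) (hMG : M * G * Mᵀ = G) :
    J.zPart M * G = -(G * (J.zPart M)ᵀ) := by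
  have hdet := (isUnit_iff_isUnit_det _).1 hM
  set C := J.linPart M with hC
  set D := J.antilinPart M with hD
  have hN : (J.mat * M * J.mat) * G * (J.mat * M * J.mat)ᵀ = G := by
    simp only [transpose_mul]
    calc _ = J.mat * (M * (J.mat * G * J.matᵀ) * Mᵀ) * J.matᵀ := by simp only [mul_assoc]
      _ = G := by rw [J.compat, hMG, J.compat]
  have h : C * G * Dᵀ + D * G * Cᵀ = 0 := by
    have : C * G * Dᵀ + D * G * Cᵀ = (1 / 2 : ℝ) • (M * G * Mᵀ -
        (J.mat * M * J.mat) * G * (J.mat * M * J.mat)ᵀ) := by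
      rw [hC, hD, linPart, antilinPart]
      generalize J.mat * M * J.mat = N'
      simp only [transpose_smul, transpose_add, transpose_sub, smul_mul_assoc, mul_smul_comm,
        add_mul, sub_mul, mul_add, mul_sub]
      module
    rw [this, hMG, hN, sub_self, smul_zero]
  have hDC : D = C * J.zPart M := (J.linPart_mul_zPart hM).symm
  rw [hDC, transpose_mul] at h
  have h' : C * (G * (J.zPart M)ᵀ + J.zPart M * G) * Cᵀ = 0 := by
    rw [← h]; noncomm_ring
  have hCt : IsUnit Cᵀ := (isUnit_transpose C).2 hM
  have h2 := (hCt.mul_left_eq_zero).1 h'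
  have h3 := (hM.mul_right_eq_zero).1 h2
  exact eq_neg_of_add_eq_zero_right h3

/-- The logarithmic derivative of the overlap along the family of states `Z₁ ↦ t Z₁`. -/
theorem trace_eq_of_overlap_equations (hG : IsUnit G) {Z₁ Z₂ S : Matrix ι ι ℝ}
    (h1 : Z₁ * J.mat = -(J.mat * Z₁)) (h2 : Z₂ * J.mat = -(J.mat * Z₂))
    (t : ℝ) (hS : S * (1 - t • (Z₁ * Z₂)) = 1) (hSJ : Commute S J.mat) (f : ℂ)
    (M : Matrix ι ι ℂ)
    (hl : (J.projQ + (t : ℂ) • (toC Z₁ * J.projP)) * M = 0)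
    (hr : M * (J.projP + toC Z₂ * J.projQ)ᵀ = 0) (hM : M + Mᵀ = f • toC G) :
    (toC G⁻¹ * (toC Z₁ * J.projP) * M).trace =
      f * LinearMap.trace ℂ J.Space (J.toComplex (S * (Z₁ * Z₂))) := by
  have hGG : toC G * toC G⁻¹ = 1 := by
    rw [← map_mul, mul_nonsing_inv _ ((isUnit_iff_isUnit_det _).1 hG), map_one]
  have hr' : (J.projP + toC Z₂ * J.projQ) * M =
      f • ((J.projP + toC Z₂ * J.projQ) * toC G) := by
    have := congrArg transpose hr
    rw [transpose_mul, transpose_transpose, transpose_zero, eq_sub_of_add_eq' hM, mul_sub,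
      mul_smul_comm] at this
    exact (sub_eq_zero.1 this).symm
  have hQ : J.projQ * M = -((t : ℂ) • (toC Z₁ * J.projP * M)) := by
    rw [add_mul, smul_mul_assoc] at hl
    exact eq_neg_of_add_eq_zero_left hl
  -- Eliminating QM between the bra and ket equations leaves a linear equation for PM. Multiplied by
  -- Z₁ from the left, it becomes one for Z₁PM with coefficient 1 − t Z₁Z₂, which S inverts.
  have hP : J.projP * M - (t : ℂ) • (toC Z₂ * toC Z₁ * (J.projP * M)) =
      f • ((J.projP + toC Z₂ * J.projQ) * toC G) := by
    rw [← hr', add_mul, mul_assoc (toC Z₂) J.projQ M, hQ, mul_neg, mul_smul_comm, sub_eq_add_neg]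
    simp only [mul_assoc]
  have hSC : toC S * (1 - (t : ℂ) • (toC Z₁ * toC Z₂)) = 1 := by
    have := congrArg toC hS
    rwa [map_mul, map_sub, map_one, toC_smul, map_mul] at this
  have hZ : toC Z₁ * J.projP * M =
      f • (toC S * toC Z₁ * (J.projP + toC Z₂ * J.projQ) * toC G) := by
    have h3 : (1 - (t : ℂ) • (toC Z₁ * toC Z₂)) * (toC Z₁ * (J.projP * M)) =
        toC Z₁ * (f • ((J.projP + toC Z₂ * J.projQ) * toC G)) := by
      rw [← hP, mul_sub, sub_mul, one_mul, mul_smul_comm, smul_mul_assoc]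
      simp only [mul_assoc]
    have h4 := congrArg (toC S * ·) h3
    simp only [← mul_assoc (toC S), hSC, one_mul] at h4
    rw [mul_assoc, h4, mul_smul_comm]
    simp only [mul_assoc]
  have hSZ : (S * Z₁) * J.mat = -(J.mat * (S * Z₁)) := by
    rw [mul_assoc, h1, mul_neg, ← mul_assoc, hSJ.eq, mul_assoc]
  -- SZ₁ is antilinear, so SZ₁P maps the range of P into that of Q and is traceless; only the term
  -- with Z₁Z₂Q survives.
  have ht0 : (toC S * toC Z₁ * J.projP).trace = 0 := by
    rw [← map_mul, ← J.projP_mul_self, ← mul_assoc, J.toC_anticomm_projP hSZ, trace_mul_cycle,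
      J.projP_mul_projQ, zero_mul, trace_zero]
  rw [mul_assoc, hZ, mul_smul_comm, trace_smul, smul_eq_mul, trace_mul_comm, mul_assoc _ (toC G),
    hGG, mul_one, mul_add, trace_add, ht0, zero_add, J.trace_toComplex
      (hSJ.mul_left (J.commute_mul_of_anticomm h1 h2)), projQ]
  congr 1
  have hts : ∀ X : Matrix ι ι ℝ, (toC X).trace = (X.trace : ℂ) := fun X => by
    simp [Matrix.trace]
  rw [← mul_assoc, ← map_mul, ← map_mul, mul_smul_comm, trace_smul, smul_eq_mul, mul_sub, mul_one,
    mul_smul_comm, trace_sub, trace_smul, ← map_mul, hts, hts, smul_eq_mul]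
  simp only [mul_assoc]

end ComplexStructure

/-! ### Matrix elements of exponentials -/

section exponential

variable {n : Type*} [Fintype n] [DecidableEq n]

theorem hasDerivAt_dotProduct_exp (u v : n → ℂ) (B : Matrix n n ℂ) (t : ℂ) :
    HasDerivAt (fun s : ℂ => u ⬝ᵥ (NormedSpace.exp (s • B) *ᵥ v))
      (u ⬝ᵥ (NormedSpace.exp (t • B) *ᵥ (B *ᵥ v))) t := by
  open scoped Norms.Operator in
  let l : Matrix n n ℂ →ₗ[ℂ] ℂ :=
    { toFun := fun Y => u ⬝ᵥ (Y *ᵥ v)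
      map_add' := fun Y Y' => by rw [add_mulVec, dotProduct_add]
      map_smul' := fun c Y => by rw [smul_mulVec, dotProduct_smul]; rfl }
  have h := l.toContinuousLinearMap.hasFDerivAt.comp_hasDerivAt t (hasDerivAt_exp_smul_const B t)
  refine h.congr_deriv ?_
  change u ⬝ᵥ ((_ * B) *ᵥ v) = _
  rw [mulVec_mulVec]
  rfl

theorem exp_commute_self (B : Matrix n n ℂ) (t : ℂ) :
    NormedSpace.exp (t • B) * B = B * NormedSpace.exp (t • B) := by
  open scoped Norms.Operator in
  exact ((hasDerivAt_exp_smul_const B t).unique (hasDerivAt_exp_smul_const' B t))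

theorem exp_eq_sum_range_of_pow_eq_zero {B : Matrix n n ℂ} {m : ℕ} (hB : B ^ m = 0) :
    NormedSpace.exp B = ∑ k ∈ Finset.range m, ((k.factorial : ℂ)⁻¹) • B ^ k := by
  rw [NormedSpace.exp_eq_tsum ℂ]
  refine tsum_eq_sum fun k hk => ?_
  rw [Finset.mem_range, not_lt] at hk
  rw [pow_eq_zero_of_le hk hB, smul_zero]

/-- Matrix elements of `exp (t B)` with `B` nilpotent are polynomials in `t`. -/
theorem exists_polynomial_dotProduct_exp (u v : n → ℂ) {B : Matrix n n ℂ} (hB : IsNilpotent B) :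
    ∃ F : Polynomial ℂ, ∀ t : ℂ, F.eval t = u ⬝ᵥ (NormedSpace.exp (t • B) *ᵥ v) := by
  obtain ⟨m, hm⟩ := hB
  refine ⟨∑ k ∈ Finset.range m, Polynomial.C ((k.factorial : ℂ)⁻¹ * (u ⬝ᵥ (B ^ k *ᵥ v))) *
    Polynomial.X ^ k, fun t => ?_⟩
  have h : (t • B) ^ m = 0 := by rw [smul_pow, hm, smul_zero]
  rw [exp_eq_sum_range_of_pow_eq_zero h, Polynomial.eval_finsetSum, sum_mulVec, dotProduct_sum]
  refine Finset.sum_congr rfl fun k _ => ?_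
  rw [smul_pow, smul_smul, smul_mulVec, dotProduct_smul]
  simp only [Polynomial.eval_mul, Polynomial.eval_C, Polynomial.eval_pow, Polynomial.eval_X,
    smul_eq_mul]
  ring

theorem dotProduct_exp_of_mulVec_eq_zero (u v : n → ℂ) {B : Matrix n n ℂ} (hB : B *ᵥ v = 0) :
    u ⬝ᵥ (NormedSpace.exp B *ᵥ v) = u ⬝ᵥ v := by
  have hd : ∀ t : ℂ, HasDerivAt (fun s : ℂ => u ⬝ᵥ (NormedSpace.exp (s • B) *ᵥ v)) 0 t :=
    fun t => (hasDerivAt_dotProduct_exp u v B t).congr_deriv (by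
      rw [hB, mulVec_zero, dotProduct_zero])
  have := is_const_of_deriv_eq_zero (fun t => (hd t).differentiableAt)
    (fun t => (hd t).deriv) 1 0
  simpa using this

/-- The function e^{−θs} u·e^{sB}v has zero derivative, because B commutes with its exponential and
can be moved next to its left eigenvector. -/
theorem dotProduct_exp_of_vecMul_eq_smul {u : n → ℂ} (v : n → ℂ) {B : Matrix n n ℂ} {θ : ℂ}
    (hB : ∀ w, u ⬝ᵥ (B *ᵥ w) = θ * (u ⬝ᵥ w)) :
    u ⬝ᵥ (NormedSpace.exp B *ᵥ v) = Complex.exp θ * (u ⬝ᵥ v) := by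
  have hd : ∀ t : ℂ, HasDerivAt (fun s : ℂ => Complex.exp (-θ * s) *
      (u ⬝ᵥ (NormedSpace.exp (s • B) *ᵥ v))) 0 t := fun t => by
    have h1 : HasDerivAt (fun s : ℂ => Complex.exp (-θ * s)) _ t :=
      ((hasDerivAt_id t).const_mul (-θ)).cexp
    refine (h1.fun_mul (hasDerivAt_dotProduct_exp u v B t)).congr_deriv ?_
    rw [mulVec_mulVec, exp_commute_self, ← mulVec_mulVec, hB]
    simp only [id, mul_one]
    ring
  have := is_const_of_deriv_eq_zero (fun t => (hd t).differentiableAt)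
    (fun t => (hd t).deriv) 1 0
  simp only [mul_one, one_smul, mul_zero, Complex.exp_zero, zero_smul, NormedSpace.exp_zero,
    one_mulVec, one_mul] at this
  rw [← this, ← mul_assoc, ← Complex.exp_add, add_neg_cancel, Complex.exp_zero, one_mul]

end exponential

/-! ### Correlation matrices and Gaussian state vectors -/

section

variable {N : ℕ} {G L : Matrix (Mode N) (Mode N) ℝ}

/-- The two-point correlation matrix `⟨u, ξ^a ξ^b v⟩` (bilinear in `u` and `v`). -/
def corr (L : Matrix (Mode N) (Mode N) ℝ) (u v : FockVec N) : Matrix (Mode N) (Mode N) ℂ :=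
  Matrix.of fun a b => u ⬝ᵥ ((majorana L a * majorana L b) *ᵥ v)

theorem corr_conj (u v : FockVec N) (X Y : Matrix (Mode N) (Mode N) ℂ) (a b : Mode N) :
    (X * corr L u v * Yᵀ) a b = u ⬝ᵥ ((linOp L X a * linOp L Y b) *ᵥ v) := by
  rw [linOp, linOp, Finset.sum_mul_sum]
  simp only [smul_mul_smul_comm, sum_mulVec, smul_mulVec,
    dotProduct_sum, dotProduct_smul, mul_apply, Finset.sum_mul, corr, of_apply, transpose_apply,
    smul_eq_mul]
  rw [Finset.sum_comm]
  exact Finset.sum_congr rfl fun c _ => Finset.sum_congr rfl fun d _ => by ring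

/-- The anticommutators fix the symmetric part of the correlations in terms of the overlap alone;
this is what lets the annihilation conditions on u and v be combined. -/
theorem corr_add_transpose (hL : L * L.transpose = G) (u v : FockVec N) :
    corr L u v + (corr L u v)ᵀ = (u ⬝ᵥ v) • toC G := by
  ext a b
  simp only [corr, Matrix.add_apply, of_apply, transpose_apply, Matrix.smul_apply]
  rw [← dotProduct_add, ← add_mulVec, majorana_anticomm hL, smul_mulVec, one_mulVec,
    dotProduct_smul, toC_apply, smul_eq_mul, smul_eq_mul, mul_comm]

theorem mul_corr_eq_zero {u : FockVec N} {X : Matrix (Mode N) (Mode N) ℂ}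
    (hu : ∀ a, u ᵥ* linOp L X a = 0) (v : FockVec N) : X * corr L u v = 0 := by
  ext a b
  have := corr_conj (L := L) u v X 1 a b
  rw [transpose_one, mul_one] at this
  rw [this, dotProduct_mulVec, ← vecMul_vecMul, hu, zero_vecMul, zero_dotProduct]
  rfl

theorem corr_mul_transpose_eq_zero (u : FockVec N) {v : FockVec N}
    {X : Matrix (Mode N) (Mode N) ℂ} (hv : ∀ a, linOp L X a *ᵥ v = 0) :
    corr L u v * Xᵀ = 0 := by
  ext a b
  have := corr_conj (L := L) u v 1 X a b
  rw [one_mul] at this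
  rw [this, ← mulVec_mulVec, hv, mulVec_zero, dotProduct_zero]
  rfl

theorem dotProduct_quadOp (u v : FockVec N) (A : Matrix (Mode N) (Mode N) ℂ) :
    u ⬝ᵥ (quadOp L A *ᵥ v) = (1 / 2 : ℂ) * (Aᵀ * corr L u v).trace := by
  rw [quadOp, smul_mulVec, dotProduct_smul, smul_eq_mul]
  congr 1
  simp only [sum_mulVec, smul_mulVec, dotProduct_sum, dotProduct_smul, Matrix.trace, diag_apply,
    mul_apply, transpose_apply, corr, of_apply, smul_eq_mul]
  exact Finset.sum_comm

theorem vecMul_linOp_mul {u : FockVec N} {Y : Matrix (Mode N) (Mode N) ℂ}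
    (hu : ∀ a, u ᵥ* linOp L Y a = 0) (X : Matrix (Mode N) (Mode N) ℂ) (a : Mode N) :
    u ᵥ* linOp L (X * Y) a = 0 := by
  rw [linOp_mul, vecMul_sum]
  exact Finset.sum_eq_zero fun b _ => by rw [vecMul_smul, hu, smul_zero]

theorem linOp_mul_mulVec {v : FockVec N} {Y : Matrix (Mode N) (Mode N) ℂ}
    (hv : ∀ a, linOp L Y a *ᵥ v = 0) (X : Matrix (Mode N) (Mode N) ℂ) (a : Mode N) :
    linOp L (X * Y) a *ᵥ v = 0 := by
  rw [linOp_mul, sum_mulVec]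
  exact Finset.sum_eq_zero fun b _ => by rw [smul_mulVec, hv, smul_zero]

theorem linOp_projP_conjTranspose (J : ComplexStructure G) (a : Mode N) :
    (linOp L J.projP a)ᴴ = linOp L J.projQ a := by
  rw [linOp, linOp, conjTranspose_sum]
  refine Finset.sum_congr rfl fun b _ => ?_
  rw [conjTranspose_smul, majorana_isHermitian]
  congr 1
  by_cases h : a = b <;>
    simp [ComplexStructure.projP, ComplexStructure.projQ, h, sub_eq_add_neg]

theorem IsGaussianState.linOp_projP_mulVec {J : ComplexStructure G} {ψ : FockVec N}
    (hψ : IsGaussianState L J ψ) (a : Mode N) : linOp L J.projP a *ᵥ ψ = 0 := by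
  rw [← hψ.2 a, linOp, sum_mulVec]
  refine Finset.sum_congr rfl fun b _ => ?_
  rw [smul_mulVec]
  rfl

theorem IsGaussianState.vecMul_linOp_projQ {J : ComplexStructure G} {ψ : FockVec N}
    (hψ : IsGaussianState L J ψ) (a : Mode N) : star ψ ᵥ* linOp L J.projQ a = 0 := by
  rw [← linOp_projP_conjTranspose, ← star_mulVec, hψ.linOp_projP_mulVec, star_zero]

/-- A dual Gaussian vector of `J'` is an eigenvector of the quadratic operators commuting with
`J'`. -/
theorem dotProduct_quadOp_of_commute (hG : IsUnit G) (hL : L * L.transpose = G)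
    {K : Matrix (Mode N) (Mode N) ℝ} (hK : IsSoGenerator G K) (J : ComplexStructure G)
    (hKJ : Commute K J.mat) {u : FockVec N} (hu : ∀ a, u ᵥ* linOp L J.projQ a = 0)
    (w : FockVec N) :
    u ⬝ᵥ (quadraticOp G L K *ᵥ w) =
      (-(1 / 4) * (K * J.mat).trace : ℝ) * Complex.I * (u ⬝ᵥ w) := by
  have hGG : toC G * toC G⁻¹ = 1 := by
    rw [← map_mul, mul_nonsing_inv _ ((isUnit_iff_isUnit_det _).1 hG), map_one]
  have hGG' : toC G⁻¹ * toC G = 1 := mul_eq_one_comm.1 hGG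
  have hGs : Gᵀ = G := by rw [← hL, transpose_mul, transpose_transpose]
  have hdet := (isUnit_iff_isUnit_det _).1 hG
  have hgKt : (G⁻¹ * K)ᵀ = -(G⁻¹ * K) := by
    have h := congrArg (fun X => G⁻¹ * X * G⁻¹) hK
    simp only [mul_neg, neg_mul] at h
    rw [mul_assoc, mul_assoc, mul_nonsing_inv _ hdet, mul_one, ← mul_assoc G⁻¹ G,
      nonsing_inv_mul _ hdet, one_mul] at h
    rw [transpose_mul, transpose_nonsing_inv, hGs, h, neg_neg]
  have htrK : K.trace = 0 := by
    have h : (G⁻¹ * (K * G)).trace = -(G⁻¹ * (G * Kᵀ)).trace := by rw [hK, mul_neg, trace_neg]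
    rw [trace_mul_comm, mul_assoc, mul_nonsing_inv _ hdet, mul_one, ← mul_assoc,
      nonsing_inv_mul _ hdet, one_mul, trace_transpose] at h
    linarith
  set M := corr L u w with hM
  have hQM : J.projQ * M = 0 := mul_corr_eq_zero hu w
  have hPM : M = J.projP * M := by
    conv_lhs => rw [← one_mul M, ← J.projP_add_projQ, add_mul, hQM, add_zero]
  have hMQ : M * J.projQᵀ = (u ⬝ᵥ w) • (J.projP * toC G) := by
    have h1 := congrArg transpose hQM
    rw [transpose_mul, eq_sub_of_add_eq' (corr_add_transpose hL u w), transpose_zero, sub_mul,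
      smul_mul_assoc, J.metric_mul_projQ_transpose] at h1
    exact (sub_eq_zero.1 h1).symm
  have hKP := J.toC_commute_projP hKJ
  have h1 : (toC (G⁻¹ * K) * M).trace = (u ⬝ᵥ w) * (toC K * J.projP).trace := by
    have hsplit : M = M * J.projQᵀ + M * J.projPᵀ := by
      rw [← mul_add, ← transpose_add, add_comm, J.projP_add_projQ, transpose_one, mul_one]
    -- Transposing P across g turns it into Q, and K commutes with P, so cycling the trace brings Q
    -- next to P. The remaining block MQᵀ is fixed by the overlap.
    have hz : (toC (G⁻¹ * K) * (M * J.projPᵀ)).trace = 0 := by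
      rw [hPM, ← mul_assoc, trace_mul_comm, map_mul, ← mul_assoc, ← mul_assoc, ← mul_assoc,
        J.projP_transpose_mul_inv hG, mul_assoc _ (toC K), hKP, mul_assoc (toC G⁻¹),
        ← mul_assoc J.projQ, J.projQ_mul_projP, zero_mul, mul_zero, zero_mul, trace_zero]
    conv_lhs => rw [hsplit]
    rw [mul_add, trace_add, hz, add_zero, hMQ, mul_smul_comm, trace_smul, smul_eq_mul, map_mul,
      ← mul_assoc, trace_mul_comm, ← mul_assoc, ← mul_assoc, hGG, one_mul]
  have hts : ∀ X : Matrix (Mode N) (Mode N) ℝ, (toC X).trace = (X.trace : ℂ) := fun X => by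
    simp only [Matrix.trace, diag_apply, toC_apply, Complex.ofReal_sum]
  rw [quadraticOp_eq_quadOp, dotProduct_quadOp, ← toC_transpose, hgKt, map_neg, neg_mul, trace_neg,
    ← hM, h1, ComplexStructure.projP, mul_smul_comm, trace_smul, mul_add, mul_one, trace_add,
    mul_smul_comm Complex.I (toC K), trace_smul, ← map_mul, hts, hts, htrK]
  simp only [smul_eq_mul]
  push_cast
  ring

end

/-! ### The phase of the overlap -/

section

variable {N : ℕ} {G L : Matrix (Mode N) (Mode N) ℝ}

theorem expectationExp_eq (K : Matrix (Mode N) (Mode N) ℝ) (ψ : FockVec N) :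
    expectationExp G L K ψ =
      star ψ ⬝ᵥ (NormedSpace.exp (quadOp L (toC G⁻¹ * toC K)) *ᵥ ψ) := by
  rw [← map_mul]; rfl

theorem toC_isSoGenerator {K : Matrix (Mode N) (Mode N) ℝ} (hK : IsSoGenerator G K) :
    toC K * toC G = -(toC G * (toC K)ᵀ) := by
  rw [← toC_transpose, ← map_mul, ← map_mul, hK, map_neg]

/-- If `linOp L X` annihilates ψ, the rotated ket e^{K̂}ψ is annihilated by the operators with
coefficients X e^{−K}. -/
theorem linOp_mul_inv_exp_mulVec (hG : IsUnit G) (hL : L * L.transpose = G)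
    {K : Matrix (Mode N) (Mode N) ℝ} (hK : IsSoGenerator G K) {ψ : FockVec N}
    {X : Matrix (Mode N) (Mode N) ℂ} (hX : ∀ a, linOp L X a *ᵥ ψ = 0) (a : Mode N) :
    linOp L (X * toC (NormedSpace.exp K)⁻¹) a *ᵥ
      (NormedSpace.exp (quadOp L (toC G⁻¹ * toC K)) *ᵥ ψ) = 0 := by
  have h : toC (NormedSpace.exp K)⁻¹ * NormedSpace.exp (toC K) = 1 := by
    rw [← toC_exp, ← map_mul, nonsing_inv_mul _ ((isUnit_iff_isUnit_det _).1 (isUnit_exp K)),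
      map_one]
  rw [mulVec_mulVec, linOp_mul_exp_quadOp hG hL (toC_isSoGenerator hK), mul_assoc, h, mul_one,
    ← mulVec_mulVec, hX, mulVec_zero]

/-- If the expectation value does not vanish, then `C` of the inverse group element is
invertible. -/
theorem isUnit_linPart_of_overlap_ne_zero (hG : IsUnit G) (hL : L * L.transpose = G)
    (J : ComplexStructure G) {u v : FockVec N} (hu : ∀ a, u ᵥ* linOp L J.projQ a = 0)
    {M : Matrix (Mode N) (Mode N) ℝ} (hM : IsUnit M)
    (hv : ∀ a, linOp L (J.projP * toC M) a *ᵥ v = 0) (huv : u ⬝ᵥ v ≠ 0) :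
    IsUnit (J.linPart M) := by
  by_contra hC
  rw [isUnit_iff_isUnit_det, isUnit_iff_ne_zero, not_not] at hC
  obtain ⟨x, hx0, hx⟩ := exists_vecMul_eq_zero_iff.2 hC
  set c := u ⬝ᵥ v with hc
  set C := J.linPart M with hCdef
  set D := J.antilinPart M with hDdef
  have hx' : (fun i => (x i : ℂ)) ᵥ* toC C = 0 := by
    funext i
    have := congrFun hx i
    simp only [vecMul, dotProduct, Pi.zero_apply, toC_apply] at this ⊢
    exact_mod_cast this
  set W := corr L u v with hW
  have hQW : J.projQ * W = 0 := mul_corr_eq_zero hu v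
  have hPW : W = J.projP * W := by
    conv_lhs => rw [← one_mul W, ← J.projP_add_projQ, add_mul, hQW, add_zero]
  -- With QW = 0 the transposed ket equation reads c(CP + DQ)G = CPW. Pairing with the left null
  -- vector x of C forces x D Q = 0 since c ≠ 0; its real part gives xD = 0, so xM = 0,
  -- contradicting invertibility of M.
  have h1 := congrArg transpose (corr_mul_transpose_eq_zero u hv)
  rw [transpose_mul, transpose_transpose, transpose_zero,
    eq_sub_of_add_eq' (corr_add_transpose hL u v), mul_sub, sub_eq_zero, J.projP_mul_toC, ← hW,
    ← hc, ← hCdef, ← hDdef, add_mul _ _ W, mul_assoc _ J.projQ, hQW, mul_zero, add_zero,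
    mul_smul_comm] at h1
  have hGG : toC G * toC G⁻¹ = 1 := by
    rw [← map_mul, mul_nonsing_inv _ ((isUnit_iff_isUnit_det _).1 hG), map_one]
  have h2 : (fun i => (x i : ℂ)) ᵥ* (toC D * J.projQ) = 0 := by
    have h := congrArg (fun X => (fun i => (x i : ℂ)) ᵥ* (X * toC G⁻¹)) h1
    simp only [smul_mul_assoc, mul_assoc, hGG, mul_one, vecMul_smul] at h
    rw [vecMul_add, ← vecMul_vecMul, ← vecMul_vecMul _ (toC C), hx', zero_vecMul,
      zero_vecMul, zero_add] at h
    exact (smul_eq_zero.1 h).resolve_left huv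
  have h3 : x ᵥ* D = 0 := by
    have h4 : ∀ Y : Matrix (Mode N) (Mode N) ℝ, ∀ i,
        ((fun i => (x i : ℂ)) ᵥ* toC Y) i = ((x ᵥ* Y) i : ℂ) := fun Y i => by
      simp [vecMul, dotProduct, toC_apply]
    funext i
    have := congrFun h2 i
    rw [ComplexStructure.projQ, mul_smul_comm, mul_sub, mul_one, mul_smul_comm, ← map_mul,
      vecMul_smul, vecMul_sub, vecMul_smul, Pi.smul_apply, Pi.sub_apply, Pi.smul_apply, h4, h4,
      Pi.zero_apply, smul_eq_mul, mul_eq_zero] at this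
    have h5 := congrArg Complex.re (this.resolve_left (by norm_num))
    simpa using h5
  have h6 : x ᵥ* M = 0 := by
    rw [← J.linPart_add_antilinPart M, vecMul_add, hx, h3, add_zero]
  exact hx0 (vecMul_injective_of_isUnit hM (h6.trans (zero_vecMul M).symm))

theorem exp_smul_of_sq_eq_zero {n : Type*} [Fintype n] [DecidableEq n] {X : Matrix n n ℂ}
    (hX : X * X = 0) (t : ℂ) : NormedSpace.exp (t • X) = 1 + t • X := by
  have : (t • X) ^ 2 = 0 := by rw [smul_pow, pow_two X, hX, smul_zero]
  rw [exp_eq_sum_range_of_pow_eq_zero this, Finset.sum_range_succ, Finset.sum_range_one]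
  simp

/-- The phase of the expectation value of a Gaussian unitary. -/
theorem arg_expectationExp (hG : IsUnit G) (hL : L * L.transpose = G)
    {K : Matrix (Mode N) (Mode N) ℝ} (hK : IsSoGenerator G K) {J : ComplexStructure G}
    {ψ : FockVec N} (hψ : IsGaussianState L J ψ) (J' : ComplexStructure G)
    (hKJ : Commute K J'.mat) {T : Matrix (Mode N) (Mode N) ℝ} (hT : IsUnit T)
    (hTG : T⁻¹ * G * (T⁻¹)ᵀ = G) (hTJ : J'.mat * T = T * J.mat)
    (hTu : IsUnit (J.linPart T⁻¹)) (hne : expectationExp G L K ψ ≠ 0) :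
    J.EtaDefined T⁻¹ (NormedSpace.exp K) ∧
      ((Complex.arg (expectationExp G L K ψ) : ℝ) : Real.Angle) =
        ((-(1 / 4) * Matrix.trace (K * J'.mat)
          - 1 / 2 * J.eta T⁻¹ (NormedSpace.exp K) : ℝ) : Real.Angle) := by
  have hGG : toC G * toC G⁻¹ = 1 := by
    rw [← map_mul, mul_nonsing_inv _ ((isUnit_iff_isUnit_det _).1 hG), map_one]
  have hGG' : toC G⁻¹ * toC G = 1 := mul_eq_one_comm.1 hGG
  set φ : FockVec N := NormedSpace.exp (quadOp L (toC G⁻¹ * toC K)) *ᵥ ψ with hφ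
  rw [expectationExp_eq, ← hφ] at hne ⊢
  set c := star ψ ⬝ᵥ φ with hc
  have hPψ := hψ.linOp_projP_mulVec
  have hQψ := hψ.vecMul_linOp_projQ
  -- the right vector
  have hV := linOp_mul_inv_exp_mulVec hG hL hK hPψ
  rw [← hφ] at hV
  set E := (NormedSpace.exp K)⁻¹ with hE
  have hEu : IsUnit E := by
    rw [hE, isUnit_nonsing_inv_iff]; exact isUnit_exp K
  have hEC : IsUnit (J.linPart E) := isUnit_linPart_of_overlap_ne_zero hG hL J hQψ hEu hV hne
  set Z₁ := J.zPart T⁻¹ with hZ₁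
  set Z₂ := J.zPart E with hZ₂
  have hZ₁J : Z₁ * J.mat = -(J.mat * Z₁) := J.zPart_mul_mat _
  have hZ₂J : Z₂ * J.mat = -(J.mat * Z₂) := J.zPart_mul_mat _
  have hR : ∀ a, linOp L (J.projP + toC Z₂ * J.projQ) a *ᵥ φ = 0 := by
    have h := linOp_mul_mulVec hV (toC (J.linPart E)⁻¹)
    have e : toC (J.linPart E)⁻¹ * (J.projP * toC E) = J.projP + toC Z₂ * J.projQ := by
      rw [J.projP_mul_toC, mul_add, ← mul_assoc, ← mul_assoc, ← map_mul, ← map_mul,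
        nonsing_inv_mul _ ((isUnit_iff_isUnit_det _).1 hEC), map_one, one_mul]
      rfl
    rwa [e] at h
  -- the left vectors
  set X := toC Z₁ * J.projP with hX
  have hXQ : J.projQ * X = X := by
    rw [hX, ← mul_assoc, ← J.toC_anticomm_projP hZ₁J, mul_assoc, J.projP_mul_self]
  have hXX : X * X = 0 := by
    rw [← hXQ, hX, mul_assoc J.projQ, mul_assoc (toC Z₁), ← mul_assoc J.projP, J.projP_mul_projQ,
      zero_mul, mul_zero, mul_zero]
  have hZG := J.zPart_mul_metric hTu hTG
  rw [← hZ₁] at hZG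
  have hXG : X * toC G = -(toC G * Xᵀ) := by
    have h1 : toC Z₁ * toC G = -(toC G * (toC Z₁)ᵀ) := toC_isSoGenerator hZG
    rw [hX, transpose_mul, ← mul_assoc, J.metric_mul_projP_transpose, mul_assoc J.projQ,
      ← neg_eq_iff_eq_neg.2 h1, mul_neg, neg_neg, ← mul_assoc, J.toC_anticomm_projP hZ₁J]
  have hgX : (toC G⁻¹ * X)ᵀ = -(toC G⁻¹ * X) := by
    have h := congrArg (fun Y => toC G⁻¹ * Y * toC G⁻¹) hXG
    have hgs : (toC G⁻¹)ᵀ = toC G⁻¹ := by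
      rw [← toC_transpose, transpose_nonsing_inv, ← hL, transpose_mul, transpose_transpose]
    simp only [mul_neg, neg_mul] at h
    rw [mul_assoc, mul_assoc, hGG, mul_one, ← mul_assoc _ (toC G), hGG', one_mul] at h
    rw [transpose_mul, hgs, h, neg_neg]
  set B := quadOp L (toC G⁻¹ * X) with hB
  -- In this form B has an annihilator of ψ in both slots, which yields its nilpotency and Bψ = 0.
  have hBP : B = quadOp L (J.projPᵀ * (toC G⁻¹ * toC Z₁) * J.projP) := by
    have h : J.projPᵀ * (toC G⁻¹ * toC Z₁) * J.projP = toC G⁻¹ * X := by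
      rw [← mul_assoc, J.projP_transpose_mul_inv hG, mul_assoc, mul_assoc, ← hX, hXQ]
    rw [h]
  have hBn : IsNilpotent B := by
    rw [hBP]; exact isNilpotent_quadOp hL J.projP_mul_metric_mul_projP_transpose _
  have hBψ : B *ᵥ ψ = 0 := by
    rw [hBP, quadOp_conj, smul_mulVec, sum_mulVec, Finset.sum_eq_zero, smul_zero]
    intro a _
    rw [sum_mulVec]
    refine Finset.sum_eq_zero fun b _ => ?_
    rw [smul_mulVec, ← mulVec_mulVec, hPψ, mulVec_zero, smul_zero]
  -- X² = 0 makes e^{tX} = 1 + tX, so conjugation by e^{tB} sends Q to Q + tX exactly.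
  have hl : ∀ (t : ℂ) a, (star ψ ᵥ* NormedSpace.exp (t • B)) ᵥ*
      linOp L (J.projQ + t • X) a = 0 := fun t a => by
    have htX : (t • X) * toC G = -(toC G * (t • X)ᵀ) := by
      rw [smul_mul_assoc, hXG, transpose_smul, mul_smul_comm, smul_neg]
    have h := linOp_mul_exp_quadOp hG hL htX J.projQ a
    rw [mul_smul_comm, quadOp_smul, ← hB, exp_smul_of_sq_eq_zero hXX, mul_add, mul_one,
      mul_smul_comm, hXQ] at h
    rw [vecMul_vecMul, ← h, ← vecMul_vecMul, hQψ, zero_vecMul]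
  -- the overlap as a polynomial
  obtain ⟨F, hF⟩ := exists_polynomial_dotProduct_exp (star ψ) φ hBn
  have hF0 : F.eval 0 = c := by
    rw [hF, zero_smul, NormedSpace.exp_zero, one_mulVec]
  set W := Z₁ * Z₂ with hW
  have hWJ : Commute W J.mat := J.commute_mul_of_anticomm hZ₁J hZ₂J
  have hWt : ∀ t : ℝ, Commute (1 - t • W) J.mat := fun t =>
    (Commute.one_left _).sub_left (hWJ.smul_left t)
  let b := Module.finBasis ℂ J.Space
  set Wm := LinearMap.toMatrix b b (J.toComplex W) with hWm
  have hmat : ∀ t : ℝ, LinearMap.toMatrix b b (J.toComplex (1 - t • W)) = 1 - (t : ℂ) • Wm :=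
    fun t => by
      rw [J.toComplex_sub (Commute.one_left _) (hWJ.smul_left t), J.toComplex_one,
        J.toComplex_smul hWJ, map_sub, map_smul, LinearMap.toMatrix_one]
  -- Invertibility is needed only near t = 0: singular points on the way to t = 1 are harmless
  -- because the resulting identity is between polynomials.
  obtain ⟨ε, hε, hunit⟩ : ∃ ε : ℝ, 0 < ε ∧ ∀ t : ℝ, |t| < ε → IsUnit (1 - t • W) := by
    have hcont : Continuous fun t : ℝ => (1 - t • W).det := by fun_prop
    have hev := hcont.continuousAt.eventually_ne (x := 0) (y := (0 : ℝ)) (by simp)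
    obtain ⟨ε, hε, h⟩ := Metric.eventually_nhds_iff.1 hev
    refine ⟨ε, hε, fun t ht => ?_⟩
    rw [isUnit_iff_isUnit_det, isUnit_iff_ne_zero]
    exact h (by rwa [Real.dist_eq, sub_zero])
  have hsq : ∀ t : ℝ, |t| < ε → F.eval (t : ℂ) ^ 2 = F.eval 0 ^ 2 * (1 - (t : ℂ) • Wm).det := by
    have hS1 : ∀ t : ℝ, |t| < ε → (1 - t • W)⁻¹ * (1 - t • W) = 1 := fun t ht =>
      nonsing_inv_mul _ ((isUnit_iff_isUnit_det _).1 (hunit t ht))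
    have hS2 : ∀ t : ℝ, |t| < ε →
        LinearMap.toMatrix b b (J.toComplex (1 - t • W)⁻¹) * (1 - (t : ℂ) • Wm) = 1 :=
      fun t ht => by
        rw [← hmat, ← LinearMap.toMatrix_mul, ← J.toComplex_mul (J.commute_inv (hWt t)) (hWt t),
          hS1 t ht, J.toComplex_one, LinearMap.toMatrix_one]
    have := sq_eq_of_logDeriv (f := fun t : ℝ => F.eval (t : ℂ))
      (f' := fun t : ℝ => (Polynomial.derivative F).eval (t : ℂ))
      (p := fun t : ℝ => (1 - (t : ℂ) • Wm).det) hε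
      (fun t _ => (F.hasDerivAt (t : ℂ)).comp_ofReal)
      (fun t ht => hasDerivAt_det_one_sub_smul Wm _ t (hS2 t ht))
      (fun t ht => (isUnit_iff_ne_zero.1 ((isUnit_iff_isUnit_det _).1
        (IsUnit.of_mul_eq_one_right _ (hS2 t ht)))))
      (by simp) (fun t ht => ?_)
    · simpa using this
    have hder : (Polynomial.derivative F).eval (t : ℂ) =
        (star ψ ᵥ* NormedSpace.exp ((t : ℂ) • B)) ⬝ᵥ (B *ᵥ φ) := by
      rw [← dotProduct_mulVec]
      refine (F.hasDerivAt (t : ℂ)).unique ?_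
      rw [show (fun x => F.eval x) = _ from funext hF]
      exact hasDerivAt_dotProduct_exp _ _ _ _
    have hval : F.eval (t : ℂ) = (star ψ ᵥ* NormedSpace.exp ((t : ℂ) • B)) ⬝ᵥ φ := by
      rw [hF, dotProduct_mulVec]
    have htr := J.trace_eq_of_overlap_equations hG hZ₁J hZ₂J t (hS1 t ht)
      (J.commute_inv (hWt t)) _ _ (mul_corr_eq_zero (hl t) φ)
      (corr_mul_transpose_eq_zero (star ψ ᵥ* NormedSpace.exp ((t : ℂ) • B)) hR)
      (corr_add_transpose hL _ _)
    rw [← hX, ← hW, J.toComplex_mul (J.commute_inv (hWt t)) hWJ,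
      LinearMap.trace_eq_matrix_trace ℂ b, LinearMap.toMatrix_mul, ← hWm, ← hval] at htr
    rw [hB, dotProduct_quadOp, hgX, neg_mul, trace_neg, ← hB, htr] at hder
    rw [hder]
    ring
  obtain ⟨s, k, hs, hF1⟩ := exists_paired_roots Wm F hε (by rwa [hF0]) hsq
  have hchar : (J.toComplex (1 - W)).charpoly = (1 - Wm).charpoly := by
    rw [← LinearMap.charpoly_toMatrix _ b]
    have := hmat 1
    simp only [one_smul, Complex.ofReal_one] at this
    rw [this]
  -- the overlap at the end point
  have hl1 : ∀ a, (star ψ ᵥ* NormedSpace.exp B) ᵥ* linOp L J'.projQ a = 0 := by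
    have h := vecMul_linOp_mul (L := L) (u := star ψ ᵥ* NormedSpace.exp B)
      (Y := J.projQ + X) (by simpa using hl 1) (toC T * toC (J.linPart T⁻¹))
    -- C_{T⁻¹}(Q + Z₁P) = Q T⁻¹ by the splitting of T⁻¹, and T Q T⁻¹ is the projection of J̃ because
    -- T carries J to J̃.
    have e : toC T * toC (J.linPart T⁻¹) * (J.projQ + X) = J'.projQ := by
      have hTT : toC T * toC T⁻¹ = 1 := by
        rw [← map_mul, mul_nonsing_inv _ ((isUnit_iff_isUnit_det _).1 hT), map_one]
      have h1 : toC (J.linPart T⁻¹) * (J.projQ + X) = J.projQ * toC T⁻¹ := by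
        rw [J.projQ_mul_toC, mul_add, hX, ← mul_assoc, ← map_mul, J.linPart_mul_zPart hTu]
      have h2 : toC T * J.projQ = J'.projQ * toC T := by
        have : toC T * toC J.mat = toC J'.mat * toC T := by rw [← map_mul, ← hTJ, map_mul]
        rw [ComplexStructure.projQ, ComplexStructure.projQ, mul_smul_comm, smul_mul_assoc,
          mul_sub, sub_mul, mul_smul_comm, smul_mul_assoc, this, mul_one, one_mul]
      rw [mul_assoc, h1, ← mul_assoc, h2, mul_assoc, hTT, mul_one]
    rwa [e] at h
  -- The bra absorbs e^{K̂} as a phase, and what remains is ⟨ψ|e^B|ψ⟩ = ⟨ψ|ψ⟩ = 1.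
  have hend : F.eval 1 = Complex.exp ((-(1 / 4) * (K * J'.mat).trace : ℝ) * Complex.I) := by
    rw [hF, one_smul, dotProduct_mulVec, hφ, ← map_mul, ← quadraticOp_eq_quadOp,
      dotProduct_exp_of_vecMul_eq_smul ψ (dotProduct_quadOp_of_commute hG hL hK J' hKJ hl1),
      ← dotProduct_mulVec, dotProduct_exp_of_mulVec_eq_zero _ _ hBψ, hψ.1, mul_one]
  rw [hF0, hend] at hF1
  have hsp : s.prod ≠ 0 := fun h => by
    rw [h, mul_zero] at hF1
    exact Complex.exp_ne_zero _ hF1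
  have hs0 : (0 : ℂ) ∉ s := fun h => hsp (Multiset.prod_eq_zero h)
  -- The padding roots drop out because arg 1 = 0, and each paired eigenvalue contributes the same
  -- principal argument twice.
  have heta : J.eta T⁻¹ (NormedSpace.exp K) = 2 * (s.map Complex.arg).sum := by
    have h := congrArg (fun r => (Multiset.map Complex.arg r).sum) hs
    simp only [Multiset.map_add, Multiset.sum_add, Multiset.map_replicate, Complex.arg_one,
      Multiset.sum_replicate, smul_zero, add_zero, Multiset.map_nsmul, Multiset.sum_nsmul] at h
    rw [ComplexStructure.eta, ← hE, ← hZ₁, ← hZ₂, ← hW, hchar, h, two_nsmul, two_mul]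
  refine ⟨⟨hTu, hEC, ?_⟩, ?_⟩
  · rw [← hE, ← hZ₁, ← hZ₂, ← hW, isUnit_iff_isUnit_det, isUnit_iff_ne_zero]
    intro hdet
    obtain ⟨v, hv0, hv⟩ := exists_mulVec_eq_zero_iff.2 hdet
    have hroot : (1 - Wm).charpoly.IsRoot 0 := by
      rw [← hchar, ← Module.End.hasEigenvalue_iff_isRoot_charpoly]
      refine Module.End.hasEigenvalue_of_hasEigenvector (x := (v : J.Space))
        (Module.End.hasEigenvector_iff.2
          ⟨Module.End.mem_eigenspace_iff.2 ?_, hv0⟩)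
      refine (J.toComplex_apply (by simpa using hWt 1) _).trans ?_
      exact hv.trans (@zero_smul ℂ J.Space _ _ _ v).symm
    have hmem : (0 : ℂ) ∈ 2 • s := by
      rw [← hs, Multiset.mem_add]
      exact Or.inl ((Polynomial.mem_roots (charpoly_monic _).ne_zero).2 hroot)
    exact hs0 (Multiset.mem_of_mem_nsmul hmem)
  · have h1 : (((-(1 / 4) * (K * J'.mat).trace : ℝ)) : Real.Angle) =
        (Complex.arg c : Real.Angle) + ((s.map Complex.arg).sum : ℝ) := by
      rw [← arg_multiset_prod s hs0, ← Complex.arg_mul_coe_angle hne hsp, ← hF1,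
        Complex.arg_exp_mul_I, Real.Angle.coe_toIocMod]
    rw [heta, Real.Angle.coe_sub, h1]
    rw [show (1 / 2 : ℝ) * (2 * (s.map Complex.arg).sum) = (s.map Complex.arg).sum by ring,
      add_sub_cancel_right]

end

/-! ### Complex structures commuting with a skew matrix -/

section

variable {ι : Type*} [Fintype ι]

theorem dotProduct_mulVec_self_of_skew {A : Matrix ι ι ℝ} (hA : Aᵀ = -A) (x y : ι → ℝ) :
    x ⬝ᵥ (A *ᵥ y) = -(y ⬝ᵥ (A *ᵥ x)) := by
  rw [← dotProduct_transpose_mulVec, hA, neg_mulVec, dotProduct_neg]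

theorem exists_smul_unit {y : ι → ℝ} (hy : y ≠ 0) : ∃ r : ℝ, (r • y) ⬝ᵥ (r • y) = 1 := by
  have hyy : 0 < y ⬝ᵥ y := by
    rw [lt_iff_le_and_ne]
    exact ⟨Finset.sum_nonneg fun i _ => mul_self_nonneg _,
      fun h => hy (dotProduct_self_eq_zero.1 h.symm)⟩
  refine ⟨(Real.sqrt (y ⬝ᵥ y))⁻¹, ?_⟩
  rw [smul_dotProduct, dotProduct_smul, smul_eq_mul, smul_eq_mul, ← mul_assoc, ← mul_inv,
    Real.mul_self_sqrt hyy.le, inv_mul_cancel₀ hyy.ne']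

theorem exists_unit_mulVec_eq {E : Matrix ι ι ℝ} (hE : E * E = E) (h0 : E ≠ 0) :
    ∃ e : ι → ℝ, e ⬝ᵥ e = 1 ∧ E *ᵥ e = e := by
  classical
  have : ∃ x, E *ᵥ x ≠ 0 := by
    by_contra! h
    exact h0 (Matrix.ext_iff_mulVec.2 fun x => by rw [h, zero_mulVec])
  obtain ⟨x, hx⟩ := this
  obtain ⟨r, hr⟩ := exists_smul_unit hx
  exact ⟨_, hr, by rw [mulVec_smul, mulVec_mulVec, hE]⟩

/-- An invariant plane of a skew-symmetric matrix inside an invariant subspace of dimension at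
least two. -/
theorem exists_invariant_plane {E K : Matrix ι ι ℝ} (hEt : Eᵀ = E) (hE : E * E = E)
    (hK : Kᵀ = -K) (hEK : E * K = K * E) (htr : 2 ≤ E.trace) :
    ∃ (e f : ι → ℝ) (μ : ℝ), e ⬝ᵥ e = 1 ∧ f ⬝ᵥ f = 1 ∧ e ⬝ᵥ f = 0 ∧ E *ᵥ e = e ∧ E *ᵥ f = f ∧
      K *ᵥ e = μ • f ∧ K *ᵥ f = -(μ • e) := by
  -- If K vanishes on the range of E, any orthonormal pair there works with μ = 0; the trace bound
  -- provides the second vector.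
  by_cases h0 : E * K = 0
  · have hE0 : E ≠ 0 := by rintro rfl; norm_num at htr
    obtain ⟨e, hee, he⟩ := exists_unit_mulVec_eq hE hE0
    have heE : e ᵥ* E = e := by rw [← mulVec_transpose, hEt, he]
    set E₁ := E - vecMulVec e e with hE₁
    have hE₁E₁ : E₁ * E₁ = E₁ := by
      rw [hE₁, sub_mul, mul_sub, mul_sub, hE, mul_vecMulVec, he, vecMulVec_mul, heE,
        vecMulVec_mul_vecMulVec, hee, one_smul, sub_self, sub_zero]
    have hE₁0 : E₁ ≠ 0 := by
      intro h
      have := congrArg trace h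
      rw [hE₁, trace_sub, trace_vecMulVec, hee, trace_zero] at this
      linarith
    obtain ⟨f, hff, hf⟩ := exists_unit_mulVec_eq hE₁E₁ hE₁0
    have hEE₁ : E * E₁ = E₁ := by rw [hE₁, mul_sub, hE, mul_vecMulVec, he]
    have heE₁ : e ᵥ* E₁ = 0 := by
      rw [hE₁, vecMul_sub, heE, vecMul_vecMulVec, hee, one_smul, sub_self]
    have hEf : E *ᵥ f = f := by
      conv_lhs => rw [← hf, mulVec_mulVec, hEE₁, hf]
    have hKz : ∀ x, E *ᵥ x = x → K *ᵥ x = 0 := fun x hx => by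
      rw [← hx, mulVec_mulVec, ← hEK, h0, zero_mulVec]
    refine ⟨e, f, 0, hee, hff, ?_, he, hEf, ?_, ?_⟩
    · rw [← hf, dotProduct_mulVec, heE₁, zero_dotProduct]
    · rw [hKz e he, zero_smul]
    · rw [hKz f hEf, zero_smul, neg_zero]
  · have hHt : ((E * K) * (E * K)).IsHermitian := by
      rw [IsHermitian, conjTranspose_eq_transpose_of_trivial]
      simp only [transpose_mul, hEt, hK]
      rw [neg_mul, neg_mul_neg, hEK]
    have hH0 : (E * K) * (E * K) ≠ 0 := by
      intro h
      apply h0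
      rw [← conjTranspose_mul_self_eq_zero, conjTranspose_eq_transpose_of_trivial, transpose_mul,
        hEt, hK, neg_mul, neg_mul, ← hEK, h, neg_zero]
    -- An eigenvector e of the symmetric matrix (EK)² with eigenvalue t ≠ 0 lies in the range of E,
    -- and t = −|Ke|² < 0. The plane is spanned by e and Ke/μ with μ = √(−t).
    obtain ⟨v, t, ht, hv, hvt⟩ := hHt.exists_eigenvector_of_ne_zero hH0
    obtain ⟨r, hr⟩ := exists_smul_unit hv
    set e := r • v with he
    have hHe : (E * K * (E * K)) *ᵥ e = t • e := by rw [he, mulVec_smul, hvt, smul_comm]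
    have hEe : E *ᵥ e = e := by
      have h1 : t • (E *ᵥ e) = t • e := by
        rw [← mulVec_smul, ← hHe, mulVec_mulVec, ← mul_assoc E, ← mul_assoc E E K, hE]
      exact smul_right_injective _ ht h1
    have hKKe : K *ᵥ (K *ᵥ e) = t • e := by
      have : E * K * (E * K) = K * K * E := by
        calc E * K * (E * K) = K * E * (K * E) := by rw [hEK]
          _ = K * (E * K) * E := by simp only [mul_assoc]
          _ = K * K * (E * E) := by rw [hEK]; simp only [mul_assoc]
          _ = K * K * E := by rw [hE]
      rw [← hHe, this, ← mulVec_mulVec, hEe, mulVec_mulVec]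
    have ht' : t = -((K *ᵥ e) ⬝ᵥ (K *ᵥ e)) := by
      have := dotProduct_mulVec_self_of_skew hK e (K *ᵥ e)
      rwa [hKKe, dotProduct_smul, hr, smul_eq_mul, mul_one] at this
    have hKe0 : 0 ≤ (K *ᵥ e) ⬝ᵥ (K *ᵥ e) := Finset.sum_nonneg fun i _ => mul_self_nonneg _
    have htneg : 0 < -t := by
      rcases lt_or_eq_of_le hKe0 with h | h
      · linarith
      · exact absurd (by rw [ht', ← h, neg_zero]) ht
    have hμ : Real.sqrt (-t) ≠ 0 := (Real.sqrt_pos.2 htneg).ne'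
    have hμμ := Real.mul_self_sqrt htneg.le
    set μ := Real.sqrt (-t)
    refine ⟨e, μ⁻¹ • (K *ᵥ e), μ, hr, ?_, ?_, hEe, ?_, ?_, ?_⟩
    · rw [smul_dotProduct, dotProduct_smul, smul_eq_mul, smul_eq_mul,
        ← neg_eq_iff_eq_neg.2 ht', ← hμμ]
      field_simp
    · have := dotProduct_mulVec_self_of_skew hK e e
      rw [dotProduct_smul, show e ⬝ᵥ (K *ᵥ e) = 0 by linarith, smul_zero]
    · rw [mulVec_smul, mulVec_mulVec, hEK, ← mulVec_mulVec, hEe]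
    · rw [smul_smul, mul_inv_cancel₀ hμ, one_smul]
    · rw [mulVec_smul, hKKe, smul_smul, ← neg_smul]
      congr 1
      field_simp
      linarith

variable [DecidableEq ι]

/-- The perturbation has rank at most two, so the determinant reduces to a 2 × 2 one. As A⁻¹ is
skew, its off-diagonal entries vanish and its diagonal entries coincide, leaving a square. -/
theorem det_add_smul_skew_plane {A : Matrix ι ι ℝ} (hA : Aᵀ = -A) (hdet : A.det ≠ 0)
    (e f : ι → ℝ) : ∃ c : ℝ, ∀ s : ℝ,
      (A + s • (vecMulVec f e - vecMulVec e f)).det = A.det * (1 + s * c) ^ 2 := by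
  have hu : IsUnit A.det := isUnit_iff_ne_zero.2 hdet
  have hAi : (A⁻¹)ᵀ = -A⁻¹ := by
    rw [transpose_nonsing_inv, hA]
    refine inv_eq_left_inv ?_
    rw [neg_mul_neg, nonsing_inv_mul _ hu]
  have hself : ∀ x : ι → ℝ, x ⬝ᵥ (A⁻¹ *ᵥ x) = 0 := fun x => by
    have := dotProduct_mulVec_self_of_skew hAi x x
    linarith
  refine ⟨e ⬝ᵥ (A⁻¹ *ᵥ f), fun s => ?_⟩
  let U : Matrix ι (Fin 2) ℝ := Matrix.of fun i k => ![f i, e i] k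
  let V : Matrix (Fin 2) ι ℝ := Matrix.of ![s • e, -(s • f)]
  have hUV : s • (vecMulVec f e - vecMulVec e f) = U * V := by
    ext i j
    simp [U, V, mul_apply, Fin.sum_univ_two, vecMulVec_apply]
    ring
  have h1 : A + U * V = A * (1 + (A⁻¹ * U) * V) := by
    rw [mul_add, mul_one, ← Matrix.mul_assoc A, ← Matrix.mul_assoc A, mul_nonsing_inv _ hu,
      Matrix.one_mul]
  have hV : ∀ k l, (V * (A⁻¹ * U)) k l = (V k) ⬝ᵥ (A⁻¹ *ᵥ (fun i => U i l)) := fun k l => rfl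
  have hU0 : (fun i => U i 0) = f := rfl
  have hU1 : (fun i => U i 1) = e := rfl
  have hV0 : V 0 = s • e := rfl
  have hV1 : V 1 = -(s • f) := rfl
  rw [hUV, h1, det_mul, det_one_add_mul_comm, det_fin_two]
  congr 1
  simp only [Matrix.add_apply, hV, hU0, hU1, hV0, hV1, smul_dotProduct, neg_dotProduct, hself,
    Matrix.one_apply, dotProduct_mulVec_self_of_skew hAi f e]
  simp
  ring

/-- Splitting off one invariant plane per induction step, A accumulates the rotations already
chosen, so invertibility is preserved throughout. -/
theorem exists_commuting_complex_structure_on_range {K : Matrix ι ι ℝ} (hK : Kᵀ = -K) (d : ℕ)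
    (E A : Matrix ι ι ℝ) (hEt : Eᵀ = E) (hE : E * E = E) (hEK : E * K = K * E)
    (htr : E.trace = 2 * d) (hA : Aᵀ = -A) (hdet : A.det ≠ 0) :
    ∃ j : Matrix ι ι ℝ, jᵀ = -j ∧ j * j = -E ∧ K * j = j * K ∧ E * j = j ∧ (A + j).det ≠ 0 := by
  induction d generalizing E A with
  | zero =>
    have hE0 : E = 0 := by
      rw [← trace_conjTranspose_mul_self_eq_zero_iff, conjTranspose_eq_transpose_of_trivial, hEt,
        hE, htr]
      simp
    exact ⟨0, by simp, by simp [hE0], by simp, by simp, by simpa using hdet⟩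
  | succ d ih =>
    obtain ⟨e, f, μ, hee, hff, hef, hEe, hEf, hKe, hKf⟩ :=
      exists_invariant_plane hEt hE hK hEK (by rw [htr]; push_cast; linarith [d.cast_nonneg (α := ℝ)])
    have hfe : f ⬝ᵥ e = 0 := by rw [dotProduct_comm, hef]
    have heE : e ᵥ* E = e := by rw [← mulVec_transpose, hEt, hEe]
    have hfE : f ᵥ* E = f := by rw [← mulVec_transpose, hEt, hEf]
    have heK : e ᵥ* K = -(μ • f) := by rw [← mulVec_transpose, hK, neg_mulVec, hKe]
    have hfK : f ᵥ* K = μ • e := by rw [← mulVec_transpose, hK, neg_mulVec, hKf, neg_neg]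
    set j₀ := vecMulVec f e - vecMulVec e f with hj₀
    set R := vecMulVec e e + vecMulVec f f with hR
    have hj₀t : j₀ᵀ = -j₀ := by
      rw [hj₀, transpose_sub, transpose_vecMulVec, transpose_vecMulVec, neg_sub]
    have hj₀j₀ : j₀ * j₀ = -R := by
      rw [hj₀, hR, sub_mul, mul_sub, mul_sub]
      simp only [vecMulVec_mul_vecMulVec, hee, hff, hef, hfe, zero_smul, one_smul, vecMulVec_zero]
      abel
    have hj₀K : K * j₀ = j₀ * K := by
      rw [hj₀, mul_sub, sub_mul]
      simp only [mul_vecMulVec, vecMulVec_mul, hKe, hKf, heK, hfK, vecMulVec_neg, neg_vecMulVec,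
        vecMulVec_smul, smul_vecMulVec]
      abel
    have hRK : R * K = K * R := by
      rw [hR, mul_add, add_mul]
      simp only [mul_vecMulVec, vecMulVec_mul, hKe, hKf, heK, hfK, vecMulVec_neg, neg_vecMulVec,
        vecMulVec_smul, smul_vecMulVec]
      abel
    have hRR : R * R = R := by
      rw [hR, add_mul, mul_add, mul_add]
      simp only [vecMulVec_mul_vecMulVec, hee, hff, hef, hfe, zero_smul, one_smul, vecMulVec_zero]
      abel
    have hER : E * R = R := by rw [hR, mul_add, mul_vecMulVec, mul_vecMulVec, hEe, hEf]
    have hRE : R * E = R := by rw [hR, add_mul, vecMulVec_mul, vecMulVec_mul, heE, hfE]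
    have hEj₀ : E * j₀ = j₀ := by rw [hj₀, mul_sub, mul_vecMulVec, mul_vecMulVec, hEe, hEf]
    have hj₀E : j₀ * E = j₀ := by rw [hj₀, sub_mul, vecMulVec_mul, vecMulVec_mul, heE, hfE]
    have hj₀R : j₀ * R = j₀ := by
      rw [hj₀, hR, sub_mul, mul_add, mul_add]
      simp only [vecMulVec_mul_vecMulVec, hee, hff, hef, hfe, zero_smul, one_smul, vecMulVec_zero]
      abel
    obtain ⟨c, hc⟩ := det_add_smul_skew_plane hA hdet e f
    -- The orientation s = ±1 of the plane is free, and 1 + c and 1 − c cannot both vanish.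
    obtain ⟨s, hs, hsdet⟩ : ∃ s : ℝ, s * s = 1 ∧ (A + s • j₀).det ≠ 0 := by
      by_cases h : 1 + c = 0
      · refine ⟨-1, by norm_num, ?_⟩
        rw [hc]
        refine mul_ne_zero hdet (pow_ne_zero 2 ?_)
        intro h'
        linarith
      · refine ⟨1, by norm_num, ?_⟩
        rw [hc, one_mul]
        exact mul_ne_zero hdet (pow_ne_zero 2 h)
    have hRt : Rᵀ = R := by
      rw [hR, transpose_add, transpose_vecMulVec, transpose_vecMulVec]
    have htrR : R.trace = 2 := by
      rw [hR, trace_add, trace_vecMulVec, trace_vecMulVec, hee, hff]; norm_num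
    obtain ⟨j, hjt, hjj, hjK, hEj, hjdet⟩ := ih (E - R) (A + s • j₀)
      (by rw [transpose_sub, hEt, hRt]) (by rw [sub_mul, mul_sub, mul_sub, hE, hER, hRE, hRR]; abel)
      (by rw [sub_mul, mul_sub, hEK, hRK]) (by rw [trace_sub, htr, htrR]; push_cast; ring)
      (by rw [transpose_add, transpose_smul, hA, hj₀t]; module) hsdet
    have hjE : j * (E - R) = j := by
      have := congrArg transpose hEj
      rwa [transpose_mul, transpose_sub, hEt, hRt, hjt, neg_mul, neg_inj] at this
    have h1 : j₀ * j = 0 := by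
      rw [← hEj, ← mul_assoc, mul_sub, hj₀E, hj₀R, sub_self, zero_mul]
    have h2 : j * j₀ = 0 := by
      have := congrArg transpose h1
      rwa [transpose_mul, hjt, hj₀t, neg_mul_neg, transpose_zero] at this
    refine ⟨s • j₀ + j, ?_, ?_, ?_, ?_, ?_⟩
    · rw [transpose_add, transpose_smul, hj₀t, hjt]; module
    · rw [add_mul, mul_add, mul_add, smul_mul_smul_comm, hs, hj₀j₀, smul_mul_assoc, mul_smul_comm,
        h1, h2, hjj]
      module
    · rw [mul_add, add_mul, mul_smul_comm, smul_mul_assoc, hj₀K, hjK]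
    · have : E * j = j := by
        rw [← hEj, ← mul_assoc, mul_sub, hE, hER]
      rw [mul_add, mul_smul_comm, hEj₀, this]
    · rwa [← add_assoc]

theorem transpose_eq_neg_of_complex_structure {J : Matrix ι ι ℝ} (hJ : J * J = -1)
    (hJt : J * Jᵀ = 1) : Jᵀ = -J := by
  have h := congrArg (J * ·) hJt
  simp only [← mul_assoc, hJ, mul_one, neg_mul, one_mul] at h
  exact neg_eq_iff_eq_neg.1 h

theorem exists_commuting_complex_structure {K J : Matrix ι ι ℝ} (hK : Kᵀ = -K)
    (hJ : J * J = -1) (hJt : J * Jᵀ = 1) {d : ℕ} (hd : Fintype.card ι = 2 * d) :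
    ∃ J' : Matrix ι ι ℝ, J' * J' = -1 ∧ J' * J'ᵀ = 1 ∧ K * J' = J' * K ∧
      (1 - J' * J).det ≠ 0 := by
  have hJt' := transpose_eq_neg_of_complex_structure hJ hJt
  have hu : IsUnit J := IsUnit.of_mul_eq_one _ hJt
  obtain ⟨j, hjt, hjj, hjK, -, hdet⟩ := exists_commuting_complex_structure_on_range hK d 1 J
    transpose_one (mul_one 1) (by rw [one_mul, mul_one]) (by rw [trace_one, hd]; push_cast; ring)
    hJt' (isUnit_iff_ne_zero.1 ((isUnit_iff_isUnit_det _).1 hu))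
  refine ⟨j, hjj, by rw [hjt, mul_neg, hjj, neg_neg], hjK, ?_⟩
  -- Hence starting the induction at A = J controls exactly the required determinant.
  have h1 : 1 - j * J = -j * (J + j) := by rw [mul_add, neg_mul, neg_mul, hjj]; abel
  have h2 : IsUnit (-j) := IsUnit.of_mul_eq_one j (by rw [neg_mul, hjj, neg_neg])
  rw [h1, det_mul]
  exact mul_ne_zero (isUnit_iff_ne_zero.1 ((isUnit_iff_isUnit_det _).1 h2)) hdet

end

/-! ### Orthogonal square roots with positive symmetric part -/

section

variable {ι : Type*} [Fintype ι] [DecidableEq ι]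

theorem eq_of_mul_self_eq_of_posSemidef {X Y : Matrix ι ι ℝ} (hX : X.PosSemidef)
    (hY : Y.PosSemidef) (h : X * X = Y * Y) : X = Y := by
  open scoped MatrixOrder Matrix.Norms.L2Operator in
  rw [← CFC.sqrt_unique h (nonneg_iff_posSemidef.2 hX),
    CFC.sqrt_unique rfl (nonneg_iff_posSemidef.2 hY)]

theorem exists_posDef_mul_self_eq {P : Matrix ι ι ℝ} (hP : P.PosDef) :
    ∃ S : Matrix ι ι ℝ, S.PosDef ∧ S * S = P := by
  open scoped MatrixOrder Matrix.Norms.L2Operator in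
  have h0 := nonneg_iff_posSemidef.2 hP.posSemidef
  have hS := CFC.sqrt_mul_sqrt_self P h0
  refine ⟨CFC.sqrt P, ?_, hS⟩
  refine ((nonneg_iff_posSemidef.1 (CFC.sqrt_nonneg P)).posDef_iff_isUnit).2 ?_
  exact isUnit_of_mul_isUnit_left (hS ▸ hP.isUnit)

/-- `T` is an orthogonal square root of `A` with positive definite symmetric part. -/
structure IsOrthogonalSqrt (A T : Matrix ι ι ℝ) : Prop where
  orth : T * Tᵀ = 1
  sq : T * T = A
  pos : (T + Tᵀ).PosDef

theorem IsOrthogonalSqrt.mul_symm_part {A T : Matrix ι ι ℝ} (h : IsOrthogonalSqrt A T) :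
    T * (T + Tᵀ) = A + 1 := by
  rw [mul_add, h.sq, h.orth]

/-- T + Tᵀ is the positive square root of A + Aᵀ + 2, so A determines it, and then T by T(T + Tᵀ) =
A + 1. -/
theorem IsOrthogonalSqrt.unique {A T T' : Matrix ι ι ℝ} (h : IsOrthogonalSqrt A T)
    (h' : IsOrthogonalSqrt A T') : T = T' := by
  have key : ∀ {U : Matrix ι ι ℝ}, IsOrthogonalSqrt A U →
      (U + Uᵀ) * (U + Uᵀ) = A + Aᵀ + 2 := fun {U} hU => by
    have h1 : Uᵀ * U = 1 := mul_eq_one_comm.1 hU.orth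
    have h2 : Uᵀ * Uᵀ = Aᵀ := by rw [← transpose_mul, hU.sq]
    rw [add_mul, mul_add, mul_add, hU.sq, hU.orth, h1, h2, ← one_add_one_eq_two]
    abel
  have hS := eq_of_mul_self_eq_of_posSemidef h.pos.posSemidef h'.pos.posSemidef
    ((key h).trans (key h').symm)
  have h1 := h.mul_symm_part
  rw [hS] at h1
  exact h'.pos.isUnit.mul_right_cancel (h1.trans h'.mul_symm_part.symm)

/-- T = (1 + A)S⁻¹ is the orthogonal polar factor of 1 + A, with S the positive root of (1 + A)(1 +
A)ᵀ. S commutes with A by uniqueness of positive roots, and T + Tᵀ = S. -/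
theorem exists_isOrthogonalSqrt {A : Matrix ι ι ℝ} (hA : A * Aᵀ = 1) (hdet : (1 + A).det ≠ 0) :
    ∃ T, IsOrthogonalSqrt A T := by
  have hA' : Aᵀ * A = 1 := mul_eq_one_comm.1 hA
  have hu : IsUnit (1 + A) := (isUnit_iff_isUnit_det _).2 (isUnit_iff_ne_zero.2 hdet)
  have hP : ((1 + A) * (1 + A)ᵀ).PosDef := by
    have := PosDef.mul_conjTranspose_self (1 + A) (vecMul_injective_of_isUnit hu)
    rwa [conjTranspose_eq_transpose_of_trivial] at this
  obtain ⟨S, hS, hSS⟩ := exists_posDef_mul_self_eq hP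
  have hPe : (1 + A) * (1 + A)ᵀ = A + Aᵀ + (1 + 1) := by
    rw [transpose_add, transpose_one, mul_add, mul_one, add_mul, one_mul, hA]
    abel
  have hSt : Sᵀ = S := by
    have := hS.isHermitian
    rwa [IsHermitian, conjTranspose_eq_transpose_of_trivial] at this
  have hAS : A * S = S * A := by
    have h1 : A * S * Aᵀ = S := by
      refine eq_of_mul_self_eq_of_posSemidef ?_ hS.posSemidef ?_
      · have := hS.posSemidef.mul_mul_conjTranspose_same A
        rwa [conjTranspose_eq_transpose_of_trivial] at this
      · calc A * S * Aᵀ * (A * S * Aᵀ) = A * (S * (Aᵀ * A) * S) * Aᵀ := by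
              simp only [mul_assoc]
          _ = A * (S * S) * Aᵀ := by rw [hA', mul_one]
          _ = S * S := by
            have h2 : A * A * Aᵀ = A := by rw [mul_assoc, hA, mul_one]
            rw [hSS, hPe]
            simp only [mul_add, add_mul, mul_one, one_mul, hA, h2]
    calc A * S = A * S * (Aᵀ * A) := by rw [hA', mul_one]
      _ = S * A := by rw [← mul_assoc, h1]
  have hSu := hS.isUnit
  have hSd := (isUnit_iff_isUnit_det _).1 hSu
  have hASi : A * S⁻¹ = S⁻¹ * A := by
    have := congrArg (fun X => S⁻¹ * X * S⁻¹) hAS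
    rw [mul_assoc, mul_assoc, mul_nonsing_inv _ hSd, mul_one, ← mul_assoc S⁻¹ S,
      nonsing_inv_mul _ hSd, one_mul] at this
    exact this.symm
  have hSi : (S⁻¹)ᵀ = S⁻¹ := by rw [transpose_nonsing_inv, hSt]
  have hT : (1 + A) * S⁻¹ = S⁻¹ * (1 + A) := by rw [add_mul, mul_add, hASi, one_mul, mul_one]
  have hii : S⁻¹ * S⁻¹ * ((1 + A) * (1 + A)ᵀ) = 1 := by
    rw [← hSS, mul_assoc, ← mul_assoc S⁻¹ S, nonsing_inv_mul _ hSd, one_mul,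
      nonsing_inv_mul _ hSd]
  have hTt : ((1 + A) * S⁻¹)ᵀ = S⁻¹ * (1 + A)ᵀ := by rw [transpose_mul, hSi]
  refine ⟨(1 + A) * S⁻¹, ?_, ?_, ?_⟩
  · rw [hTt, hT, mul_assoc, ← mul_assoc (1 + A), hT, mul_assoc, ← mul_assoc, hii]
  · have h1 : (1 + A) * (1 + A) = (1 + A) * (1 + A)ᵀ * A := by
      rw [mul_assoc, transpose_add, transpose_one, add_mul 1 Aᵀ, hA', one_mul, add_comm A]
    rw [hT, mul_assoc, ← mul_assoc (1 + A), hT, mul_assoc, ← mul_assoc, h1, ← mul_assoc, hii,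
      one_mul]
  · have h1 : (1 + A) * S⁻¹ + ((1 + A) * S⁻¹)ᵀ = S := by
      rw [hTt, hT, ← mul_add]
      have h2 : 1 + A + (1 + A)ᵀ = S * S := by
        rw [hSS, hPe, transpose_add, transpose_one]; abel
      rw [h2, ← mul_assoc, nonsing_inv_mul _ hSd, one_mul]
    rw [h1]; exact hS

/-- An orthogonal matrix of determinant −1 has the eigenvalue −1, on whose eigenvector T + Tᵀ would
be negative. -/
theorem IsOrthogonalSqrt.det_eq_one {A T : Matrix ι ι ℝ} (h : IsOrthogonalSqrt A T) :
    T.det = 1 := by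
  have h1 : T.det * T.det = 1 := by
    have := congrArg det h.orth
    rwa [det_mul, det_transpose, det_one] at this
  rcases mul_self_eq_one_iff.1 h1 with h2 | h2
  · exact h2
  exfalso
  have h3 : (1 + T).det = -(1 + T).det := by
    have : 1 + T = T * (1 + T)ᵀ := by
      rw [transpose_add, transpose_one, mul_add, mul_one, h.orth, add_comm]
    conv_lhs => rw [this]
    rw [det_mul, det_transpose, h2, neg_one_mul]
  have h4 : (1 + T).det = 0 := by linarith
  obtain ⟨v, hv0, hv⟩ := exists_mulVec_eq_zero_iff.2 h4
  have h5 : T *ᵥ v = -v := by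
    rw [add_mulVec, one_mulVec] at hv
    exact (neg_eq_of_add_eq_zero_right hv).symm
  have h6 := h.pos.dotProduct_mulVec_pos hv0
  rw [star_trivial, add_mulVec, dotProduct_add, dotProduct_transpose_mulVec, h5,
    dotProduct_neg] at h6
  have h7 : 0 ≤ v ⬝ᵥ v := Finset.sum_nonneg fun i _ => mul_self_nonneg _
  linarith

theorem posDef_symm_part_iff {T : Matrix ι ι ℝ} (hT : T * Tᵀ = 1) :
    (T + Tᵀ).PosDef ↔ ∀ z ∈ spectrum ℂ (toC T), 0 < z.re := by
  constructor
  · intro h z hz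
    have h1 : ¬ IsUnit (algebraMap ℂ (Matrix ι ι ℂ) z - toC T) := hz
    rw [isUnit_iff_isUnit_det, isUnit_iff_ne_zero, not_not] at h1
    obtain ⟨w, hw0, hw⟩ := exists_mulVec_eq_zero_iff.2 h1
    rw [sub_mulVec, sub_eq_zero, Algebra.algebraMap_eq_smul_one, smul_mulVec, one_mulVec] at hw
    have hre : T *ᵥ (fun i => (w i).re) = z.re • (fun i => (w i).re) - z.im • (fun i => (w i).im) := by
      funext i
      have := congrArg Complex.re (congrFun hw i)
      simpa [mulVec, dotProduct, toC_apply] using this.symm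
    have him : T *ᵥ (fun i => (w i).im) = z.re • (fun i => (w i).im) + z.im • (fun i => (w i).re) := by
      funext i
      have := congrArg Complex.im (congrFun hw i)
      simpa [mulVec, dotProduct, toC_apply] using this.symm
    set x : ι → ℝ := fun i => (w i).re with hx
    set y : ι → ℝ := fun i => (w i).im with hy
    have hq : ∀ v : ι → ℝ, v ⬝ᵥ ((T + Tᵀ) *ᵥ v) = 2 * (v ⬝ᵥ (T *ᵥ v)) := fun v => by
      rw [add_mulVec, dotProduct_add, dotProduct_transpose_mulVec, two_mul]
    have hsum : x ⬝ᵥ ((T + Tᵀ) *ᵥ x) + y ⬝ᵥ ((T + Tᵀ) *ᵥ y) =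
        2 * z.re * (x ⬝ᵥ x + y ⬝ᵥ y) := by
      rw [hq, hq, hre, him, dotProduct_sub, dotProduct_add, dotProduct_smul, dotProduct_smul,
        dotProduct_smul, dotProduct_smul, dotProduct_comm y x]
      simp only [smul_eq_mul]
      ring
    have hnn : ∀ v : ι → ℝ, 0 ≤ v ⬝ᵥ ((T + Tᵀ) *ᵥ v) := fun v => by
      simpa using h.posSemidef.dotProduct_mulVec_nonneg v
    have hxy : 0 ≤ x ⬝ᵥ x + y ⬝ᵥ y :=
      add_nonneg (Finset.sum_nonneg fun i _ => mul_self_nonneg _)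
        (Finset.sum_nonneg fun i _ => mul_self_nonneg _)
    have hpos : 0 < x ⬝ᵥ ((T + Tᵀ) *ᵥ x) + y ⬝ᵥ ((T + Tᵀ) *ᵥ y) := by
      by_cases hx0 : x = 0
      · have hy0 : y ≠ 0 := by
          intro hy0
          apply hw0
          funext i
          exact Complex.ext (congrFun hx0 i) (congrFun hy0 i)
        exact add_pos_of_nonneg_of_pos (hnn x) (by simpa using h.dotProduct_mulVec_pos hy0)
      · exact add_pos_of_pos_of_nonneg (by simpa using h.dotProduct_mulVec_pos hx0) (hnn y)
    rw [hsum] at hpos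
    by_contra hz'
    push Not at hz'
    nlinarith
  · intro h
    have hS : (T + Tᵀ).IsHermitian := by
      rw [IsHermitian, conjTranspose_eq_transpose_of_trivial, transpose_add, transpose_transpose,
        add_comm]
    rw [hS.posDef_iff_eigenvalues_pos]
    intro i
    set l := hS.eigenvalues i with hl
    obtain ⟨v, hv0, hv⟩ : ∃ v : ι → ℝ, v ≠ 0 ∧ (T + Tᵀ) *ᵥ v = l • v :=
      ⟨_, (WithLp.ofLp_eq_zero 2).ne.2 (hS.eigenvectorBasis.orthonormal.ne_zero i),
        hS.mulVec_eigenvectorBasis i⟩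
    -- With z⁻¹ = l − z, the product (z − T)(z⁻¹ − T) = 1 − lT + T² kills v, so z or z⁻¹ is an
    -- eigenvalue of T. Their real parts have equal sign and sum to l.
    obtain ⟨z, hz⟩ : ∃ z : ℂ, z * (l - z) = 1 := by
      obtain ⟨s, hs⟩ := IsAlgClosed.exists_eq_mul_self ((l : ℂ) ^ 2 - 4)
      exact ⟨(l + s) / 2, by linear_combination (1 / 4) * hs⟩
    have hz0 : z ≠ 0 := by rintro rfl; simp at hz
    have hsing : ¬ IsUnit ((algebraMap ℂ (Matrix ι ι ℂ) z - toC T) *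
        (algebraMap ℂ (Matrix ι ι ℂ) (l - z) - toC T)) := by
      rw [isUnit_iff_isUnit_det, isUnit_iff_ne_zero, not_not]
      refine exists_mulVec_eq_zero_iff.1 ⟨fun i => (v i : ℂ), fun h0 => hv0 ?_, ?_⟩
      · funext i; simpa using congrFun h0 i
      · have e : (algebraMap ℂ (Matrix ι ι ℂ) z - toC T) *
            (algebraMap ℂ (Matrix ι ι ℂ) (l - z) - toC T) = toC (1 - l • T + T * T) := by
          rw [Algebra.algebraMap_eq_smul_one, Algebra.algebraMap_eq_smul_one, map_add, map_sub, map_one,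
            map_mul, toC_smul]
          simp only [mul_sub, sub_mul, smul_mul_assoc, mul_smul_comm, one_mul, mul_one, smul_sub,
            smul_smul]
          have hz' : (l : ℂ) * z - z * z = 1 := by rw [← hz]; ring
          rw [hz']
          module
        have e2 : (1 - l • T + T * T) *ᵥ v = 0 := by
          have h1 := congrArg (T *ᵥ ·) hv
          rw [mulVec_mulVec, mul_add, hT, mulVec_smul, add_mulVec, one_mulVec] at h1
          rw [add_mulVec, sub_mulVec, one_mulVec, smul_mulVec, ← h1]
          abel
        rw [e]
        funext i
        have := congrFun e2 i
        simp only [mulVec, dotProduct, toC_apply, Pi.zero_apply] at this ⊢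
        exact_mod_cast this
    have hinv : (l : ℂ) - z = z⁻¹ := eq_inv_of_mul_eq_one_right hz
    have hcase : 0 < z.re ∨ 0 < (z⁻¹).re := by
      by_contra! hcon
      apply hsing
      refine IsUnit.mul ?_ ?_
      · exact not_not.1 fun hn => absurd (h z hn) (not_lt.2 hcon.1)
      · rw [hinv]
        exact not_not.1 fun hn => absurd (h z⁻¹ hn) (not_lt.2 hcon.2)
    have hns : 0 < Complex.normSq z := Complex.normSq_pos.2 hz0
    have hlre : l = z.re + (z⁻¹).re := by
      have := congrArg Complex.re hinv
      simp only [Complex.sub_re, Complex.ofReal_re] at this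
      linarith
    rw [Complex.inv_re] at hlre hcase
    have hzre : 0 < z.re := by
      rcases hcase with h1 | h1
      · exact h1
      · exact (div_pos_iff_of_pos_right hns).1 h1
    rw [hlre]
    positivity

/-- J Tᵀ Jᵀ is another square root of the same kind, hence equals T; combined with J' = T²J this
gives J' = TJT⁻¹. -/
theorem IsOrthogonalSqrt.intertwines {J J' T : Matrix ι ι ℝ} (hJ : J * J = -1) (hJt : Jᵀ = -J)
    (hJt' : J'ᵀ = -J') (h : IsOrthogonalSqrt (-(J' * J)) T) :
    J * Tᵀ = T * J ∧ J' * T = T * J := by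
  have hT' : Tᵀ * T = 1 := mul_eq_one_comm.1 h.orth
  have hJu : IsUnit J := IsUnit.of_mul_eq_one (-J) (by rw [mul_neg, hJ, neg_neg])
  have hJJ : J * Jᵀ = 1 := by rw [hJt, mul_neg, hJ, neg_neg]
  have hJJ' : Jᵀ * J = 1 := mul_eq_one_comm.1 hJJ
  have h2 : IsOrthogonalSqrt (-(J' * J)) (J * Tᵀ * Jᵀ) := by
    have ht : (J * Tᵀ * Jᵀ)ᵀ = J * T * Jᵀ := by
      simp only [transpose_mul, transpose_transpose, mul_assoc]
    refine ⟨?_, ?_, ?_⟩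
    · rw [ht]
      calc _ = J * (Tᵀ * (Jᵀ * J) * T) * Jᵀ := by simp only [mul_assoc]
        _ = 1 := by rw [hJJ', mul_one, hT', mul_one, hJJ]
    · calc _ = J * (Tᵀ * (Jᵀ * J) * Tᵀ) * Jᵀ := by simp only [mul_assoc]
        _ = J * (T * T)ᵀ * Jᵀ := by rw [hJJ', mul_one, transpose_mul]
        _ = J * J * (J' * J) := by
          rw [h.sq, transpose_neg, transpose_mul, hJt, hJt']
          simp only [mul_neg, neg_mul, neg_neg, mul_assoc]
        _ = -(J' * J) := by rw [hJ, neg_one_mul]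
    · rw [ht]
      have := h.pos.mul_mul_conjTranspose_same (B := J) (vecMul_injective_of_isUnit hJu)
      rw [conjTranspose_eq_transpose_of_trivial] at this
      convert this using 1
      noncomm_ring
  have h3 : J * Tᵀ = T * J := by
    have := congrArg (· * J) (h2.unique h)
    rwa [mul_assoc _ Jᵀ, hJJ', mul_one] at this
  refine ⟨h3, ?_⟩
  have h4 : J * T = Tᵀ * J := by
    have := congrArg (fun X => Tᵀ * X * T) h3
    rw [mul_assoc, mul_assoc J, hT', mul_one, ← mul_assoc, hT', one_mul] at this
    exact this.symm
  have h5 : J' = T * T * J := by rw [h.sq, neg_mul, mul_assoc, hJ, mul_neg_one, neg_neg]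
  rw [h5, mul_assoc, h4, ← mul_assoc, mul_assoc T T, h.orth, mul_one]

end

/-! ### Transport from the standard metric to G -/

section

variable {ι : Type*} [Fintype ι] [DecidableEq ι]

theorem metric_iff_orthogonal {G L Li T₀ : Matrix ι ι ℝ} (hL : L * Lᵀ = G) (h1 : Li * L = 1) :
    (L * T₀ * Li) * G * (L * T₀ * Li)ᵀ = G ↔ T₀ * T₀ᵀ = 1 := by
  have h1' : Lᵀ * Liᵀ = 1 := by rw [← transpose_mul, h1, transpose_one]
  have e : (L * T₀ * Li) * G * (L * T₀ * Li)ᵀ = L * (T₀ * T₀ᵀ) * Lᵀ := by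
    rw [← hL]
    simp only [transpose_mul]
    calc _ = L * T₀ * (Li * L) * (Lᵀ * Liᵀ) * T₀ᵀ * Lᵀ := by simp only [mul_assoc]
      _ = _ := by rw [h1, h1']; simp only [mul_assoc, mul_one]
  rw [e]
  constructor
  · intro h
    have := congrArg (fun X => Li * X * Liᵀ) (h.trans hL.symm)
    calc T₀ * T₀ᵀ = (Li * L) * (T₀ * T₀ᵀ) * (Lᵀ * Liᵀ) := by rw [h1, h1', one_mul, mul_one]
      _ = Li * (L * (T₀ * T₀ᵀ) * Lᵀ) * Liᵀ := by simp only [mul_assoc]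
      _ = Li * (L * Lᵀ) * Liᵀ := this
      _ = (Li * L) * (Lᵀ * Liᵀ) := by simp only [mul_assoc]
      _ = 1 := by rw [h1, h1', one_mul]
  · intro h
    rw [h, mul_one, hL]

theorem isPrincipalSqrt_conj_iff {G L Li : Matrix ι ι ℝ} (hL : L * Lᵀ = G) (h1 : Li * L = 1)
    (h2 : L * Li = 1) {A₀ T₀ : Matrix ι ι ℝ} :
    IsPrincipalSqrt G (L * A₀ * Li) (L * T₀ * Li) ↔ IsOrthogonalSqrt A₀ T₀ := by
  have hsq : (L * T₀ * Li) * (L * T₀ * Li) = L * A₀ * Li ↔ T₀ * T₀ = A₀ := by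
    have e : (L * T₀ * Li) * (L * T₀ * Li) = L * (T₀ * T₀) * Li := by
      calc _ = L * T₀ * (Li * L) * T₀ * Li := by simp only [mul_assoc]
        _ = _ := by rw [h1, mul_one]; simp only [mul_assoc]
    rw [e]
    constructor
    · intro h
      have := congrArg (fun X => Li * X * L) h
      calc T₀ * T₀ = (Li * L) * (T₀ * T₀) * (Li * L) := by rw [h1, one_mul, mul_one]
        _ = Li * (L * (T₀ * T₀) * Li) * L := by simp only [mul_assoc]
        _ = Li * (L * A₀ * Li) * L := this
        _ = (Li * L) * A₀ * (Li * L) := by simp only [mul_assoc]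
        _ = A₀ := by rw [h1, one_mul, mul_one]
    · intro h; rw [h]
  have hspec : spectrum ℂ ((L * T₀ * Li).map (fun x : ℝ => (x : ℂ))) = spectrum ℂ (toC T₀) := by
    let u : (Matrix ι ι ℂ)ˣ := ⟨toC L, toC Li, by rw [← map_mul, h2, map_one],
      by rw [← map_mul, h1, map_one]⟩
    change spectrum ℂ (toC (L * T₀ * Li)) = _
    rw [map_mul, map_mul]
    exact spectrum.units_conjugate (u := u)
  have hdet : (L * T₀ * Li).det = T₀.det := by
    rw [det_mul, det_mul, mul_right_comm, ← det_mul, h2, det_one, one_mul]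
  rw [IsPrincipalSqrt, IsSpecialOrthogonal, metric_iff_orthogonal hL h1, hsq, hspec, hdet]
  constructor
  · rintro ⟨⟨ho, -⟩, hs, hp⟩
    exact ⟨ho, hs, (posDef_symm_part_iff ho).2 hp⟩
  · intro h
    exact ⟨⟨h.orth, h.det_eq_one⟩, h.sq, (posDef_symm_part_iff h.orth).1 h.pos⟩

end

end FermionicGaussian
end

/-! ### Assembly of the result -/

theorem mainTheorem3 (N : ℕ)
    (G L : Matrix (FermionicGaussian.Mode N) (FermionicGaussian.Mode N) ℝ)
    (hG : G.PosDef) (hL : L * L.transpose = G)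
    (K : Matrix (FermionicGaussian.Mode N) (FermionicGaussian.Mode N) ℝ)
    (hK : FermionicGaussian.IsSoGenerator G K)
    (J : FermionicGaussian.ComplexStructure G)
    (ψ : FermionicGaussian.FockVec N)
    (hψ : FermionicGaussian.IsGaussianState L J ψ) :
    (∃ J' : FermionicGaussian.ComplexStructure G,
      Commute K J'.mat ∧ (1 - J'.mat * J.mat).det ≠ 0) ∧
    ∀ J' : FermionicGaussian.ComplexStructure G,
      Commute K J'.mat → (1 - J'.mat * J.mat).det ≠ 0 →
      (∃! T, FermionicGaussian.IsPrincipalSqrt G (-(J'.mat * J.mat)) T) ∧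
      ∀ T, FermionicGaussian.IsPrincipalSqrt G (-(J'.mat * J.mat)) T →
        FermionicGaussian.expectationExp G L K ψ ≠ 0 →
        J.EtaDefined T⁻¹ (NormedSpace.exp K) ∧
        ((Complex.arg (FermionicGaussian.expectationExp G L K ψ) : ℝ) : Real.Angle) =
          ((-(1 / 4) * Matrix.trace (K * J'.mat)
            - 1 / 2 * J.eta T⁻¹ (NormedSpace.exp K) : ℝ) : Real.Angle) := by
  open FermionicGaussian in
  have hGu : IsUnit G := hG.isUnit
  have hLu : IsUnit L := by
    rw [← hL] at hGu
    exact isUnit_of_mul_isUnit_left hGu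
  have hLd := (isUnit_iff_isUnit_det _).1 hLu
  have h1 : L⁻¹ * L = 1 := nonsing_inv_mul _ hLd
  have h2 : L * L⁻¹ = 1 := mul_nonsing_inv _ hLd
  set Li := L⁻¹ with hLi
  have hLiu : IsUnit Li := IsUnit.of_mul_eq_one _ h1
  -- Conjugation by L reduces the metric to the identity, where compatible complex structures are
  -- skew and orthogonal.
  obtain ⟨conj, hconj⟩ : ∃ c : Matrix (Mode N) (Mode N) ℝ → Matrix (Mode N) (Mode N) ℝ,
      ∀ X, c X = Li * X * L := ⟨_, fun _ => rfl⟩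
  have hback : ∀ X, L * conj X * Li = X := fun X => by
    rw [hconj]
    calc _ = (L * Li) * X * (L * Li) := by simp only [mul_assoc]
      _ = X := by rw [h2, one_mul, mul_one]
  have hconj_mul : ∀ X Y, conj (X * Y) = conj X * conj Y := fun X Y => by
    rw [hconj, hconj, hconj]
    calc _ = Li * X * 1 * Y * L := by simp only [mul_assoc, one_mul]
      _ = _ := by rw [← h2]; simp only [mul_assoc]
  have hconj_neg : ∀ X, conj (-X) = -conj X := fun X => by
    rw [hconj, hconj, mul_neg, neg_mul]
  have hconj_one : conj 1 = 1 := by rw [hconj, mul_one, h1]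
  have horth : ∀ J : ComplexStructure G, conj J.mat * (conj J.mat)ᵀ = 1 := fun J => by
    rw [← metric_iff_orthogonal hL h1, hback]
    exact J.compat
  have hsq : ∀ J : ComplexStructure G, conj J.mat * conj J.mat = -1 := fun J => by
    rw [← hconj_mul, J.sq, hconj_neg, hconj_one]
  have hskew : ∀ J : ComplexStructure G, (conj J.mat)ᵀ = -conj J.mat := fun J =>
    transpose_eq_neg_of_complex_structure (hsq J) (horth J)
  have hdetconj : ∀ X, (L * X * Li).det = X.det := fun X => by
    rw [det_mul, det_mul, mul_right_comm, ← det_mul, h2, det_one, one_mul]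
  refine ⟨?_, fun J' hKJ hdet => ?_⟩
  · have hKs : (conj K)ᵀ = -conj K := by
      have h3 : conj K * (Li * G) = -(Li * G * Kᵀ) := by
        rw [hconj]
        calc Li * K * L * (Li * G) = Li * K * (L * Li) * G := by simp only [mul_assoc]
          _ = Li * (K * G) := by rw [h2, mul_one, mul_assoc]
          _ = -(Li * G * Kᵀ) := by rw [hK, mul_neg, mul_assoc]
      have h4 : Li * G = Lᵀ := by rw [← hL, ← mul_assoc, h1, one_mul]
      have h5 : Lᵀ * Liᵀ = 1 := by rw [← transpose_mul, h1, transpose_one]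
      rw [h4] at h3
      have h6 : conj K = -(Lᵀ * Kᵀ * Liᵀ) := by
        have := congrArg (· * Liᵀ) h3
        simp only [neg_mul] at this
        rwa [mul_assoc, h5, mul_one] at this
      have h7 : (conj K)ᵀ = Lᵀ * Kᵀ * Liᵀ := by
        rw [hconj, transpose_mul, transpose_mul, ← mul_assoc]
      rw [h7, h6, neg_neg]
    obtain ⟨j, hj, hjt, hjK, hjd⟩ := exists_commuting_complex_structure hKs (hsq J) (horth J)
      (d := N) (by rw [Fintype.card_sum, Fintype.card_fin, two_mul])
    have hjc : conj (L * j * Li) = j := by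
      rw [hconj]
      calc _ = (Li * L) * j * (Li * L) := by simp only [mul_assoc]
        _ = j := by rw [h1, one_mul, mul_one]
    refine ⟨⟨L * j * Li, ?_, (metric_iff_orthogonal hL h1).2 hjt⟩, ?_, ?_⟩
    · rw [← hback (L * j * Li * (L * j * Li)), hconj_mul, hjc, hj, mul_neg, neg_mul, mul_one, h2]
    · change K * (L * j * Li) = L * j * Li * K
      rw [← hback (K * (L * j * Li)), hconj_mul, hjc, hjK, ← hback (L * j * Li * K),
        hconj_mul, hjc]
    · have : (1 : Matrix (Mode N) (Mode N) ℝ) - L * j * Li * J.mat =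
          L * (1 - j * conj J.mat) * Li := by
        rw [mul_sub, sub_mul, mul_one, h2, hconj]
        congr 1
        calc _ = L * j * Li * J.mat * 1 := by rw [mul_one]
          _ = _ := by rw [← h2]; simp only [mul_assoc]
      rw [this, hdetconj]
      exact hjd
  set A₀ := -(conj J'.mat * conj J.mat) with hA₀
  have hA : -(J'.mat * J.mat) = L * A₀ * Li := by
    rw [← hback (-(J'.mat * J.mat)), hconj_neg, hconj_mul]
  have hA₀t : A₀ * A₀ᵀ = 1 := by
    rw [hA₀, transpose_neg, neg_mul_neg, transpose_mul]
    calc _ = conj J'.mat * (conj J.mat * (conj J.mat)ᵀ) * (conj J'.mat)ᵀ := by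
          simp only [mul_assoc]
      _ = 1 := by rw [horth J, mul_one, horth J']
  have hA₀d : (1 + A₀).det ≠ 0 := by
    rw [← hdetconj, mul_add, mul_one, add_mul, h2, ← hA, ← sub_eq_add_neg]
    exact hdet
  rw [hA]
  have hiff : ∀ T, IsPrincipalSqrt G (L * A₀ * Li) T ↔ IsOrthogonalSqrt A₀ (conj T) := fun T => by
    conv_lhs => rw [← hback T]
    exact isPrincipalSqrt_conj_iff hL h1 h2
  refine ⟨?_, fun T hT hne => ?_⟩
  · obtain ⟨T₀, hT₀⟩ := exists_isOrthogonalSqrt hA₀t hA₀d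
    refine ⟨L * T₀ * Li, (isPrincipalSqrt_conj_iff hL h1 h2).2 hT₀, fun T hT => ?_⟩
    rw [← hback T, ((hiff T).1 hT).unique hT₀]
  have hT₀ := (hiff T).1 hT
  obtain ⟨hi1, hi2⟩ := hT₀.intertwines (hsq J) (hskew J) (hskew J')
  have hTinv : T⁻¹ = L * (conj T)ᵀ * Li := by
    refine inv_eq_right_inv ?_
    rw [← hback (T * _), hconj_mul]
    have : conj (L * (conj T)ᵀ * Li) = (conj T)ᵀ := by
      rw [hconj]
      calc _ = (Li * L) * (conj T)ᵀ * (Li * L) := by simp only [mul_assoc]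
        _ = _ := by rw [h1, one_mul, mul_one]
    rw [this, hT₀.orth, mul_one, h2]
  have hTu : IsUnit T := by
    rw [isUnit_iff_isUnit_det, hT.1.2]; exact isUnit_one
  refine arg_expectationExp hGu hL hK hψ J' hKJ hTu ?_ ?_ ?_ hne
  · rw [hTinv, metric_iff_orthogonal hL h1, transpose_transpose]
    exact mul_eq_one_comm.1 hT₀.orth
  · rw [← hback (J'.mat * T), hconj_mul, hi2, ← hconj_mul, hback]
  -- In the standard metric J Tᵀ J = −T, so C_{T⁻¹} is the symmetric part of T, invertible because
  -- it is positive definite.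
  · have : J.linPart T⁻¹ = L * ((1 / 2 : ℝ) • (conj T + (conj T)ᵀ)) * Li := by
      rw [ComplexStructure.linPart, hTinv, mul_smul_comm, smul_mul_assoc]
      congr 1
      have h3 : J.mat * (L * (conj T)ᵀ * Li) * J.mat = -(L * conj T * Li) := by
        conv_lhs => rw [← hback J.mat]
        calc _ = L * (conj J.mat * ((Li * L) * (conj T)ᵀ * (Li * L)) * conj J.mat) * Li := by
              simp only [mul_assoc]
          _ = -(L * conj T * Li) := by
              rw [h1, one_mul, mul_one, hi1, mul_assoc (conj T), hsq, mul_neg_one, mul_neg,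
                neg_mul]
      rw [h3, mul_add, add_mul]
      abel
    rw [this]
    refine (hLu.mul ?_).mul hLiu
    exact (hT₀.pos.smul (by norm_num)).isUnit
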